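/- Let $D\subset\mathbb{R}^d$ ($d\ge 1$) be a bounded domain (non-empty, open, connected) with closure $\overline D$, let $\lambda:\overline D\to(0,\infty)$ be continuous, and let $\mathcal{S}(\overline D)$ be the space of lower semi-continuous functions $\overline D\to\mathbb{R}\cup\{+\infty\}$, with the topology generated by the sets $\{f:\inf_U f<t\}$ ($U\subset\overline D$ relatively open, $t\in\mathbb{R}$) and $\{f:\inf_K f>t\}$ ($K\subset\overline D$ compact, $t\in\mathbb{R}$), and with its Borel $\sigma$-algebra. Let $W_\lambda$ be a random element of $\mathcal{S}(\overline D)$, defined on some probability space, such that 1. for every closed $C\subset\overline D$, $\min_C W_\lambda$ is exponentially distributed with rate $\int_C\lambda(x)\,dx$ (rate $0$ meaning that the minimum is a.s. $+\infty$; $\min_\emptyset=+\infty$); 2. for every finite family of disjoint closed sets $C_1,\dots,C_n\subset\overline D$, the random variables $\min_{C_1}W_\lambda,\dots,\min_{C_n}W_\lambda$ are independent. For $f:\overline D\to\mathbb{R}\cup\{+\infty\}$ put $m_1(f)=\inf_{\overline D} f$, $M_1(f)=\{x: f(x)=m_1(f)\}$ and, for $k\ge2$, $m_k(f)=\inf\{f(x):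 x\in\overline D\setminus\bigcup_{i<k}M_i(f)\}$, $M_k(f)=\{x: m_{k-1}(f)<f(x)=m_k(f)\}$. The elements of $M_k(f)$ are the $k$-th argmins of $f$. Let $g\in\mathcal{S}(\overline D)$ be finite on a set of positive Lebesgue measure. Then: (a) With probability one, $M_k(W_\lambda+g)$ consists of exactly one point for every $k\ge1$. (b) For every $k\ge1$, if $X^{(1)},\dots,X^{(k)}$ are $\overline D$-valued with $X^{(j)}\in M_j(W_\lambda+g)$ almost surely for $j=1,\dots,k$, then (up to null sets) they are measurable, and the law of $(X^{(1)},\dots,X^{(k)})$ on $\overline D^{\,k}$ has, with respect to $dx_1\cdots dx_k$, the density $$\prod_{j=1}^k\lambda(x_j)\ \int_{\mathbb{R}^{k-1}}\Phi\bigl(x_k,(g-r_{k-1})^+\bigr)\,\Psi(x_1,r_1,g)\prod_{j=2}^{k-1}\Psi\bigl(x_j,r_j-r_{j-1},(g-r_{j-1})^+\bigr)\,dr_1\cdots dr_{k-1},$$ which for $k=1$ is read as $\lambda(x_1)\,\Phi(x_1,g)$. Here, for $h:\overline D\to\mathbb{R}\cup\{+\infty\}$, $$\Phi(z,h)=\int_{h(z)}^\infty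 \exp\Bigl(-\bar\lambda\int_{-\infty}^t H_{\lambda,h}(s)\,ds\Bigr)dt,\qquad \Psi(z,t,h)=\mathbf 1_{\{t>h(z)\}}\exp\Bigl(-\bar\lambda\int_{-\infty}^t H_{\lambda,h}(s)\,ds\Bigr),$$ $$H_{\lambda,h}(s)=\mu_\lambda(\{x\in\overline D: h(x)\le s\}),\qquad \bar\lambda=\int_{\overline D}\lambda(x)\,dx,\qquad \mu_\lambda(E)=\frac1{\bar\lambda}\int_E\lambda(x)\,dx .$$ -/

import Mathlib

open MeasureTheory ProbabilityTheory

attribute [local instance] MeasureTheory.Measure.Subtype.measureSpace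

/-- The space `S(X)` of lower semi-continuous functions on `X` with values in `ℝ ∪ {+∞}`. -/
structure LscFun (X : Type*) [TopologicalSpace X] where
  /-- the underlying function -/
  toFun : X → EReal
  /-- it is lower semi-continuous -/
  lsc : LowerSemicontinuous toFun
  /-- it does not take the value `-∞` -/
  ne_bot : ∀ x, toFun x ≠ ⊥

namespace LscFun

instance (X : Type*) [TopologicalSpace X] : CoeFun (LscFun X) (fun _ => X → EReal) where
  coe := LscFun.toFun

/-- The infimum of `f` over `A`. It is attained when `f` is lower semi-continuous and `A` is compact
and non-empty, and it is `+∞` for empty `A`. -/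
noncomputable def infOn {X : Type*} (f : X → EReal) (A : Set X) : EReal := ⨅ x ∈ A, f x

/-- The topology of `Γ`-convergence on `S(X)`: it is generated by the sets `{f | inf_U f < t}` with
`U` open and the sets `{f | t < inf_K f}` with `K` compact (`t` real). -/
instance (X : Type*) [TopologicalSpace X] : TopologicalSpace (LscFun X) :=
  TopologicalSpace.generateFrom
    ({S | ∃ (U : Set X) (t : ℝ), IsOpen U ∧ S = {f : LscFun X | infOn f U < (t : EReal)}} ∪
      {S | ∃ (K : Set X) (t : ℝ), IsCompact K ∧ S = {f : LscFun X | (t : EReal) < infOn f K}})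

/-- `S(X)` carries the Borel sigma-algebra of the topology of `Γ`-convergence. -/
instance (X : Type*) [TopologicalSpace X] : MeasurableSpace (LscFun X) := borel _

instance (X : Type*) [TopologicalSpace X] : BorelSpace (LscFun X) := ⟨rfl⟩

end LscFun

namespace ExtremeValue

open LscFun

section Argmins

variable {X : Type*}

/-- The pair `(m_k(f), M_1(f) ∪ … ∪ M_k(f))`, by recursion on `k`; the value `(-∞, ∅)` at `k = 0` is
the start of the recursion. -/
noncomputable def kthMinAux (f : X → EReal) : ℕ → EReal × Set X
  | 0 => (⊥, ∅)
  | k + 1 =>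
    (infOn f (kthMinAux f k).2ᶜ,
      (kthMinAux f k).2 ∪
        {x | (kthMinAux f k).1 < f x ∧ f x = infOn f (kthMinAux f k).2ᶜ})

/-- The number `m_k(f)`, for `k ≥ 1`. -/
noncomputable def kthMin (f : X → EReal) (k : ℕ) : EReal := (kthMinAux f k).1

/-- The set `M_k(f)` of `k`-th argmins of `f`, for `k ≥ 1`. -/
def kthArgmins (f : X → EReal) (k : ℕ) : Set X :=
  {x | kthMin f (k - 1) < f x ∧ f x = kthMin f k}

theorem kthMinAux_snd (f : X → EReal) (k : ℕ) :
    (kthMinAux f k).2 = ⋃ i ∈ Finset.Icc 1 k, kthArgmins f i := by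
  induction k with
  | zero => simp [kthMinAux]
  | succ k ih =>
    rw [← Finset.insert_Icc_right_eq_Icc_add_one (by omega), Finset.set_biUnion_insert, ← ih,
      Set.union_comm]
    rfl

/-- `m_1(f)` is the infimum of `f` over the whole space. -/
theorem kthMin_one (f : X → EReal) : kthMin f 1 = ⨅ x, f x := by
  simp [kthMin, kthMinAux, infOn]

/-- `M_1(f)` is the set of minimizers of `f`. -/
theorem kthArgmins_one (f : X → EReal) (hf : ∀ x, f x ≠ ⊥) :
    kthArgmins f 1 = {x | f x = kthMin f 1} := by
  ext x
  simp [kthArgmins, kthMin, kthMinAux, bot_lt_iff_ne_bot, hf x]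

/-- `m_{k+1}(f)` is the infimum of `f` off `M_1(f) ∪ … ∪ M_k(f)`. -/
theorem kthMin_succ (f : X → EReal) (k : ℕ) :
    kthMin f (k + 1) = infOn f (⋃ i ∈ Finset.Icc 1 k, kthArgmins f i)ᶜ := by
  rw [← kthMinAux_snd]
  rfl

end Argmins

/-- The exponential distribution of rate `r ≥ 0`, as a measure on the extended reals; for `r = 0` it
is the point mass at `+∞`. -/
noncomputable def expLaw (r : ℝ) : Measure EReal :=
  if 0 < r then (expMeasure r).map (fun t : ℝ => (t : EReal)) else Measure.dirac ⊤

/-- `W` is an extreme-value process `W_lam` on `X`: a random element of `S(X)` whose minimum over any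
closed set `C` is exponentially distributed with rate `∫_C lam(x) dx`, and whose minima over
disjoint closed sets are independent. -/
structure IsExtremeValueProcess {X : Type*} [TopologicalSpace X] [MeasureSpace X]
    {Ω : Type*} [MeasurableSpace Ω] (P : Measure Ω) (lam : X → ℝ) (W : Ω → LscFun X) : Prop where
  measurable : Measurable W
  hasLaw_min : ∀ C : Set X, IsClosed C →
    HasLaw (fun ω => infOn (W ω) C) (expLaw (∫ x in C, lam x)) P
  iIndepFun_min : ∀ (n : ℕ) (C : Fin n → Set X), (∀ i, IsClosed (C i)) →
    (∀ i j, i ≠ j → Disjoint (C i) (C j)) → iIndepFun (fun i ω => infOn (W ω) (C i)) P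

section Density

variable {X : Type*} [MeasureSpace X]

/-- The total rate `∫ lam(x) dx`. -/
noncomputable def totalRate (lam : X → ℝ) : ℝ := ∫ x, lam x

/-- The probability measure `μ_lam` with density `lam` divided by the total rate. -/
noncomputable def rateMeasure (lam : X → ℝ) : Measure X :=
  (ENNReal.ofReal (totalRate lam))⁻¹ • volume.withDensity (fun x => ENNReal.ofReal (lam x))

/-- The cumulative distribution function `H_{lam,h}(s) = μ_lam({h ≤ s})`. -/
noncomputable def cumul (lam : X → ℝ) (h : X → EReal) (s : ℝ) : ℝ :=
  (rateMeasure lam).real {x | h x ≤ (s : EReal)}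

/-- The factor `exp (- totalRate * ∫_{-∞}^t H_{lam,h}(s) ds)`. -/
noncomputable def survival (lam : X → ℝ) (h : X → EReal) (t : ℝ) : ℝ :=
  Real.exp (-(totalRate lam * ∫ s in Set.Iic t, cumul lam h s))

/-- The kernel `Φ(z, h)`. -/
noncomputable def Phi (lam : X → ℝ) (z : X) (h : X → EReal) : ENNReal :=
  ∫⁻ t in {t : ℝ | h z < (t : EReal)}, ENNReal.ofReal (survival lam h t)

open Classical in
/-- The kernel `Ψ(z, t, h)`. -/
noncomputable def Psi (lam : X → ℝ) (z : X) (t : ℝ) (h : X → EReal) : ENNReal :=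
  if h z < (t : EReal) then ENNReal.ofReal (survival lam h t) else 0

/-- The function `(g - r)⁺`. -/
noncomputable def shiftPos (g : X → EReal) (r : ℝ) : X → EReal :=
  fun x => max (g x - (r : EReal)) 0

/-- The iterated integral in the joint density of the first `k` argmins, at `(x_1, …, x_k)`: for
`k = 1` it is `Φ(x_1, g)` (there is nothing to integrate), and for `k ≥ 2` it is the integral over
`(r_1, …, r_{k-1}) ∈ ℝ^{k-1}` of
`Φ(x_k, (g - r_{k-1})⁺) Ψ(x_1, r_1, g) ∏_{j=2}^{k-1} Ψ(x_j, r_j - r_{j-1}, (g - r_{j-1})⁺)`.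
(The value for `k = 0` is never used.) -/
noncomputable def argminKernel (lam : X → ℝ) (g : X → EReal) :
    (k : ℕ) → (Fin k → X) → ENNReal
  | 0, _ => 1
  | 1, x => Phi lam (x 0) g
  | n + 2, x => ∫⁻ r : Fin (n + 1) → ℝ,
      Phi lam (x (Fin.last (n + 1))) (shiftPos g (r (Fin.last n))) *
        Psi lam (x 0) (r 0) g *
        ∏ j : Fin n, Psi lam (x j.succ.castSucc) (r j.succ - r j.castSucc)
          (shiftPos g (r j.castSucc))

/-- The joint density of the first `k` argmins with respect to `dx_1 ⋯ dx_k`. -/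
noncomputable def argminDensity (lam : X → ℝ) (g : X → EReal) (k : ℕ) (x : Fin k → X) : ENNReal :=
  (∏ j, ENNReal.ofReal (lam (x j))) * argminKernel lam g k x

end Density

end ExtremeValue

/-! Let `μ` be the intensity `λ dx`, let `Λ(t) = ∫ (t - g)⁺ dμ` (`hazard`), and let `h(t) = μ {g ≤
t}` be its right derivative (`hazardRate`). A subscript `B` means that `μ` is restricted to `B`.

The finite values of `W` behave like a Poisson process of intensity `μ ⊗ dt`: the probability that
`W ≥ φ` everywhere is `exp (-∫ φ dμ)` for every measurable `φ ≥ 0` with finite integral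
(`HasClosedVoidProbabilities.hasVoidProbabilities`). On a set `B`, `W + g ≥ t` means `W ≥ (t - g)⁺`.
Hence the infima of `W + g` over disjoint measurable boxes are independent, with survival functions
`exp (-Λ_B(t))` (`boxMin_joint`, `map_boxMin_eq_pi`).

The boxes are the level sets of the first `N` bits of an injective Borel coding of the space by
binary sequences. Refining them shows that almost surely `W + g` has finitely many points below each
level, no two points with the same finite value, and infinitely many finite values
(`ae_hasSimpleSublevels`). Statement (a) follows for each such function.

For (b), the identity `(u - (g - r)⁺)⁺ + (r - g)⁺ = (r + u - g)⁺`, valid for `u ≥ 0`, makes the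
product of the `Ψ` and `Φ` telescope. The claimed density becomes `∏ λ(x_j)` times the integral of
`exp (-Λ(t_k))` over `t_1 < … < t_k` with `t_j > g(x_j)`. Its mass on `A_1 × … × A_k` is the
integral of `∏ h_{A_j}(t_j) exp (-Λ(t_k))` over increasing `t`. For disjoint boxes this is at most
the probability that the box minima occur in the given order, below the minimum over the rest
(`le_measure_strictMono_boxMin`). When the argmins lie in different boxes, that event says which
boxes they are in. So the claimed law is dominated by the true one up to the mass of tuples sharing
a box, which vanishes as `N → ∞`. Both are probability measures, so this one-sided bound already
forces equality. -/

namespace ExtremeValue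

open LscFun Set Filter Topology
open scoped ENNReal NNReal

/-! ### Exponentials and the exponential law on the extended reals -/

/-- The function `exp (-a)` for `a : ℝ≥0∞`, meant for finite `a`. -/
noncomputable def expNeg (a : ℝ≥0∞) : ℝ≥0∞ := ENNReal.ofReal (Real.exp (-a.toReal))

theorem expNeg_zero : expNeg 0 = 1 := by simp [expNeg]

theorem expNeg_add {a b : ℝ≥0∞} (ha : a ≠ ∞) (hb : b ≠ ∞) :
    expNeg (a + b) = expNeg a * expNeg b := by
  rw [expNeg, expNeg, expNeg, ← ENNReal.ofReal_mul (Real.exp_nonneg _), ← Real.exp_add,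
    ENNReal.toReal_add ha hb, neg_add]

theorem expNeg_sum {ι : Type*} (s : Finset ι) {a : ι → ℝ≥0∞} (ha : ∀ i ∈ s, a i ≠ ∞) :
    expNeg (∑ i ∈ s, a i) = ∏ i ∈ s, expNeg (a i) := by
  classical
  induction s using Finset.induction_on with
  | empty => simp [expNeg_zero]
  | insert i s hi ih =>
    have hs : ∀ j ∈ s, a j ≠ ∞ := fun j hj => ha j (Finset.mem_insert_of_mem hj)
    rw [Finset.sum_insert hi, Finset.prod_insert hi,
      expNeg_add (ha i (Finset.mem_insert_self _ _)) (ENNReal.sum_ne_top.2 hs), ih hs]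

theorem expNeg_ne_top (a : ℝ≥0∞) : expNeg a ≠ ∞ := ENNReal.ofReal_ne_top

/-- This is `1 + x ≤ exp x`. It turns void probabilities into first-moment bounds. -/
theorem one_sub_expNeg_le {a : ℝ≥0∞} (ha : a ≠ ∞) : 1 - expNeg a ≤ a := by
  rw [tsub_le_iff_right]
  conv_rhs => rw [← ENNReal.ofReal_toReal ha, expNeg,
    ← ENNReal.ofReal_add ENNReal.toReal_nonneg (Real.exp_nonneg _)]
  rw [← ENNReal.ofReal_one, ENNReal.ofReal_toReal ha]
  apply ENNReal.ofReal_le_ofReal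
  have := Real.add_one_le_exp (-a.toReal)
  linarith

theorem expNeg_anti {a b : ℝ≥0∞} (hab : a ≤ b) (hb : b ≠ ∞) : expNeg b ≤ expNeg a :=
  ENNReal.ofReal_le_ofReal <| Real.exp_le_exp.2 <| neg_le_neg <| ENNReal.toReal_mono hb hab

theorem tendsto_expNeg {α : Type*} {l : Filter α} {u : α → ℝ≥0∞} {a : ℝ≥0∞}
    (h : Tendsto u l (𝓝 a)) (ha : a ≠ ∞) : Tendsto (fun i => expNeg (u i)) l (𝓝 (expNeg a)) :=
  ENNReal.tendsto_ofReal <| (Real.continuous_exp.tendsto _).comp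
    ((ENNReal.tendsto_toReal ha).comp h).neg

theorem expMeasure_Ici {r t : ℝ} (hr : 0 < r) (ht : 0 ≤ t) :
    expMeasure r (Ici t) = ENNReal.ofReal (Real.exp (-(r * t))) := by
  have := isProbabilityMeasure_expMeasure hr
  have h0 : expMeasure r {t} = 0 :=
    (withDensity_absolutelyContinuous (volume : Measure ℝ) (gammaPDF 1 r)) (measure_singleton t)
  have h1 : Ici t =ᵐ[expMeasure r] Ioi t := by
    rw [← Ioi_insert, insert_eq]
    exact union_ae_eq_right_of_ae_eq_empty
      (measure_eq_zero_iff_ae_notMem.1 h0 |>.mono fun x hx => eq_false hx)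
  rw [measure_congr h1, ← compl_Iic, prob_compl_eq_one_sub measurableSet_Iic,
    ← ENNReal.ofReal_toReal (measure_ne_top (expMeasure r) (Iic t)), ← measureReal_def,
    ← cdf_eq_real, cdf_expMeasure_eq hr, if_pos ht, ← ENNReal.ofReal_one,
    ← ENNReal.ofReal_sub _ (by
      rw [sub_nonneg, Real.exp_le_one_iff]; nlinarith)]
  congr 1
  ring

theorem expLaw_Ici {r : ℝ} (hr : 0 ≤ r) {t : ℝ≥0∞} (ht : t ≠ ∞) :
    expLaw r (Ici (t : EReal)) = expNeg (t * ENNReal.ofReal r) := by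
  lift t to ℝ≥0 using ht
  have hcoe : ((t : ℝ≥0∞) : EReal) = ((t : ℝ) : EReal) := rfl
  rcases hr.eq_or_lt with rfl | hr
  · simp [expLaw, expNeg]
  · have hpre : (fun s : ℝ => (s : EReal)) ⁻¹' Ici ((t : ℝ) : EReal) = Ici (t : ℝ) := by
      ext s; simp
    rw [expLaw, if_pos hr, hcoe, Measure.map_apply measurable_coe_real_ereal measurableSet_Ici,
      hpre]
    refine (expMeasure_Ici hr t.2).trans ?_
    rw [expNeg, ENNReal.toReal_mul, ENNReal.toReal_ofReal hr.le,
      mul_comm]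
    rfl

theorem le_infOn_iff {X : Type*} {f : X → EReal} {A : Set X} {t : EReal} :
    t ≤ infOn f A ↔ ∀ x ∈ A, t ≤ f x := by
  simp [infOn]

theorem infOn_le {X : Type*} {f : X → EReal} {A : Set X} {x : X} (hx : x ∈ A) :
    infOn f A ≤ f x := iInf₂_le x hx

/-! ### Void probabilities -/

/-- The random function `w` behaves like a Poisson point process of intensity `μ ⊗ dt`, where the
points below the graph of `φ` are those `x` with `w x < φ x`. -/
structure HasVoidProbabilities {X Ω : Type*} [MeasurableSpace X] [MeasurableSpace Ω]
    (P : Measure Ω) (μ : Measure X) (w : Ω → X → EReal) : Prop where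
  nullMeasurableSet : ∀ φ : X → ℝ≥0∞, Measurable φ → ∫⁻ x, φ x ∂μ ≠ ∞ →
    NullMeasurableSet {ω | ∀ x, (φ x : EReal) ≤ w ω x} P
  measure_eq : ∀ φ : X → ℝ≥0∞, Measurable φ → ∫⁻ x, φ x ∂μ ≠ ∞ →
    P {ω | ∀ x, (φ x : EReal) ≤ w ω x} = expNeg (∫⁻ x, φ x ∂μ)

/-- The void probabilities of `w` for step functions supported by closed sets. -/
structure HasClosedVoidProbabilities {X Ω : Type*} [TopologicalSpace X] [MeasurableSpace X]
    [MeasurableSpace Ω] (P : Measure Ω) (μ : Measure X) (w : Ω → X → EReal) : Prop where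
  nullMeasurableSet : ∀ (C : Set X) (t : ℝ≥0∞), IsClosed C →
    NullMeasurableSet {ω | ∀ x ∈ C, (t : EReal) ≤ w ω x} P
  measure_eq : ∀ (n : ℕ) (C : Fin n → Set X) (t : Fin n → ℝ≥0∞), (∀ i, IsClosed (C i)) →
    (∀ i j, i ≠ j → Disjoint (C i) (C j)) → (∀ i, t i ≠ ∞) →
    P {ω | ∀ i, ∀ x ∈ C i, (t i : EReal) ≤ w ω x} = expNeg (∑ i, t i * μ (C i))

theorem ofReal_setIntegral_eq_withDensity {X : Type*} [MeasureSpace X] {lam : X → ℝ}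
    (hlam : Integrable lam) (hpos : ∀ x, 0 < lam x) {C : Set X} (hC : MeasurableSet C) :
    ENNReal.ofReal (∫ x in C, lam x)
      = (volume : Measure X).withDensity (fun x => ENNReal.ofReal (lam x)) C := by
  rw [withDensity_apply _ hC,
    ofReal_integral_eq_lintegral_ofReal hlam.integrableOn (ae_of_all _ fun x => (hpos x).le)]

/-- This extracts all that the later argument needs from the extreme-value process: the minima over
disjoint closed sets are independent exponentials, so their survival probabilities multiply. -/
theorem IsExtremeValueProcess.hasClosedVoidProbabilities {X : Type*} [TopologicalSpace X]
    [MeasureSpace X] [OpensMeasurableSpace X] {Ω : Type*} [MeasurableSpace Ω] {P : Measure Ω}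
    {lam : X → ℝ} {W : Ω → LscFun X} (hW : IsExtremeValueProcess P lam W) (hlam : Integrable lam)
    (hpos : ∀ x, 0 < lam x) :
    HasClosedVoidProbabilities P (volume.withDensity fun x => ENNReal.ofReal (lam x))
      (fun ω => (W ω : X → EReal)) where
  nullMeasurableSet C t hC := by
    have h := (hW.hasLaw_min C hC).aemeasurable.nullMeasurable
      (measurableSet_Ici (a := (t : EReal)))
    convert h using 1
    ext ω
    simp [le_infOn_iff]
  measure_eq n C t hC hd ht := by
    have hfin : ∀ i, (volume.withDensity fun x => ENNReal.ofReal (lam x)) (C i) ≠ ∞ := fun i => by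
      rw [← ofReal_setIntegral_eq_withDensity hlam hpos (hC i).measurableSet]
      exact ENNReal.ofReal_ne_top
    have h := (hW.iIndepFun_min n C hC hd).meas_iInter
      (s := fun i => (fun ω => infOn (W ω) (C i)) ⁻¹' Ici (t i : EReal))
      (fun i => ⟨_, measurableSet_Ici, rfl⟩)
    rw [expNeg_sum _ fun i _ => ENNReal.mul_ne_top (ht i) (hfin i)]
    convert h using 2 with i
    · ext ω
      simp [le_infOn_iff]
    · have hl := hW.hasLaw_min (C i) (hC i)
      rw [← Measure.map_apply_of_aemeasurable hl.aemeasurable measurableSet_Ici, hl.map_eq,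
        expLaw_Ici (integral_nonneg fun x => (hpos x).le) (ht i),
        ofReal_setIntegral_eq_withDensity hlam hpos (hC i).measurableSet]

/-! ### From closed step functions to measurable functions -/

section Extension

variable {X : Type*} [PseudoEMetricSpace X] [MeasurableSpace X]
  {Ω : Type*} [MeasurableSpace Ω] {P : Measure Ω} [IsProbabilityMeasure P]
  {μ : Measure X} {w : Ω → X → EReal}

variable [IsFiniteMeasure μ]

theorem HasClosedVoidProbabilities.measure_exists_lt_le (h : HasClosedVoidProbabilities P μ w)
    {C : Set X} (hC : IsClosed C) {t : ℝ≥0∞} (ht : t ≠ ∞) :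
    P {ω | ∃ x ∈ C, w ω x < t} ≤ t * μ C := by
  have h1 := h.measure_eq 1 (fun _ => C) (fun _ => t) (fun _ => hC)
    (fun i j hij => (hij (Subsingleton.elim _ _)).elim) (fun _ => ht)
  simp only [forall_const, Finset.univ_unique, Finset.sum_const, Finset.card_singleton,
    one_smul] at h1
  have h2 : {ω | ∃ x ∈ C, w ω x < t} = {ω | ∀ x ∈ C, (t : EReal) ≤ w ω x}ᶜ := by
    ext ω; simp
  rw [h2, prob_compl_eq_one_sub₀ (h.nullMeasurableSet C t hC), h1]
  exact one_sub_expNeg_le (ENNReal.mul_ne_top ht (measure_ne_top _ _))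

variable [BorelSpace X]

/-- Outer regularity encloses `N` in an open set of small measure, which closed sets exhaust from
inside; the first-moment bound applies to those. The lemma is needed because the events quantify
over every point, so a `μ`-null part of the space cannot be discarded without it. -/
theorem HasClosedVoidProbabilities.ae_eq_top_of_null (h : HasClosedVoidProbabilities P μ w)
    {N : Set X} (hN : μ N = 0) : ∀ᵐ ω ∂P, ∀ x ∈ N, w ω x = ⊤ := by
  have key : ∀ t : ℕ, P {ω | ∃ x ∈ N, w ω x < ((t : ℝ≥0∞) : EReal)} = 0 := by
    intro t
    refine le_antisymm (ENNReal.le_of_forall_pos_le_add fun ε hε _ => ?_) zero_le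
    -- Dividing by `t + 1` instead of `t` avoids the case `t = 0`.
    have hpos : μ N < ε / (t + 1) := by
      rw [hN]
      exact ENNReal.div_pos (by exact_mod_cast hε.ne') (by finiteness)
    obtain ⟨U, hNU, hU, hUε⟩ := N.exists_isOpen_lt_of_lt _ hpos
    obtain ⟨F, hF, -, hFU, hmono⟩ := hU.exists_iUnion_isClosed
    have hsub : {ω | ∃ x ∈ N, w ω x < ((t : ℝ≥0∞) : EReal)}
        ⊆ ⋃ n, {ω | ∃ x ∈ F n, w ω x < ((t : ℝ≥0∞) : EReal)} := by
      rintro ω ⟨x, hx, hlt⟩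
      obtain ⟨n, hn⟩ := mem_iUnion.1 (hFU ▸ hNU hx : x ∈ ⋃ n, F n)
      exact mem_iUnion.2 ⟨n, x, hn, hlt⟩
    calc P {ω | ∃ x ∈ N, w ω x < ((t : ℝ≥0∞) : EReal)}
        ≤ P (⋃ n, {ω | ∃ x ∈ F n, w ω x < ((t : ℝ≥0∞) : EReal)}) := measure_mono hsub
      -- Continuity from below for a monotone sequence needs no measurability of these events.
      _ = ⨆ n, P {ω | ∃ x ∈ F n, w ω x < ((t : ℝ≥0∞) : EReal)} :=
          Monotone.measure_iUnion fun m n hmn ω ⟨x, hx, hlt⟩ => ⟨x, hmono hmn hx, hlt⟩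
      _ ≤ t * μ U := iSup_le fun n =>
          (h.measure_exists_lt_le (hF n) (ENNReal.natCast_ne_top t)).trans <| by
            gcongr
            exact hFU ▸ subset_iUnion F n
      _ ≤ (t + 1) * (ε / (t + 1)) := by
          gcongr
          exact le_self_add
      _ ≤ 0 + ε := by rw [zero_add]; exact ENNReal.mul_div_le
  have hall : ∀ᵐ ω ∂P, ∀ t : ℕ, ¬ ∃ x ∈ N, w ω x < ((t : ℝ≥0∞) : EReal) :=
    ae_all_iff.2 fun t => by
      rw [ae_iff]
      simpa using key t
  filter_upwards [hall] with ω hω x hx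
  refine (EReal.eq_top_iff_forall_lt _).2 fun y => ?_
  obtain ⟨n, hn⟩ := exists_nat_gt y
  have := hω n
  push Not at this
  refine lt_of_lt_of_le (EReal.coe_lt_coe_iff.2 hn) ?_
  exact_mod_cast this x hx

theorem exists_monotone_isClosed {B : Set X} (hB : MeasurableSet B) :
    ∃ K : ℕ → Set X, (∀ m, IsClosed (K m)) ∧ (∀ m, K m ⊆ B) ∧ Monotone K ∧
      μ (B \ ⋃ m, K m) = 0 := by
  have hex : ∀ m : ℕ, ∃ F ⊆ B, IsClosed F ∧ μ (B \ F) < ((m : ℝ≥0∞) + 1)⁻¹ := fun m =>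
    hB.exists_isClosed_sdiff_lt (measure_ne_top _ _) (by simp)
  choose F hFB hF hFμ using hex
  refine ⟨accumulate F, fun m => ?_, fun m => ?_, monotone_accumulate, ?_⟩
  · rw [accumulate_def]
    exact (finite_le_nat m).isClosed_biUnion fun i _ => hF i
  · rw [accumulate_def]
    exact iUnion₂_subset fun i _ => hFB i
  · refine le_antisymm (ENNReal.le_of_forall_pos_le_add fun ε hε _ => ?_) zero_le
    obtain ⟨m, hm⟩ := ENNReal.exists_inv_nat_lt (a := ε) (by exact_mod_cast hε.ne')
    rw [zero_add, iUnion_accumulate]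
    calc μ (B \ ⋃ m, F m) ≤ μ (B \ F m) :=
          measure_mono (sdiff_subset_sdiff_right (subset_iUnion F m))
      _ ≤ ((m : ℝ≥0∞) + 1)⁻¹ := (hFμ m).le
      _ ≤ (m : ℝ≥0∞)⁻¹ := ENNReal.inv_le_inv.2 le_self_add
      _ ≤ ε := hm.le

/-- Each fibre of `φ` is exhausted by closed subsets up to a null set. The closed subsets of
different fibres are disjoint, so the closed case applies at each stage, and the events decrease to
the required one. -/
theorem HasClosedVoidProbabilities.simpleFunc (h : HasClosedVoidProbabilities P μ w)
    (φ : SimpleFunc X ℝ≥0∞) (hφ : ∀ x, φ x ≠ ∞) :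
    NullMeasurableSet {ω | ∀ x, (φ x : EReal) ≤ w ω x} P ∧
      P {ω | ∀ x, (φ x : EReal) ≤ w ω x} = expNeg (∫⁻ x, φ x ∂μ) := by
  classical
  have hK := fun c : ℝ≥0∞ => exists_monotone_isClosed (μ := μ) (φ.measurableSet_fiber c)
  choose K hKc hKsub hKmono hKnull using hK
  set E : ℕ → Set Ω := fun m => {ω | ∀ c : φ.range, ∀ x ∈ K c m, ((c : ℝ≥0∞) : EReal) ≤ w ω x}
    with hE
  have hEm : ∀ m, NullMeasurableSet (E m) P := fun m => by
    have : E m = ⋂ c : φ.range, {ω | ∀ x ∈ K c m, ((c : ℝ≥0∞) : EReal) ≤ w ω x} := by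
      ext ω; simp only [hE, mem_ofPred_eq, mem_iInter]
    rw [this]
    exact NullMeasurableSet.iInter fun c => h.nullMeasurableSet _ _ (hKc _ m)
  have hEanti : Antitone E := fun m n hmn ω hω c x hx => hω c x (hKmono _ hmn hx)
  have hrange : ∀ c : φ.range, (c : ℝ≥0∞) ≠ ∞ := fun c => by
    obtain ⟨x, hx⟩ := SimpleFunc.mem_range.1 c.2
    exact hx ▸ hφ x
  have hEP : ∀ m, P (E m) = expNeg (∑ c : φ.range, (c : ℝ≥0∞) * μ (K c m)) := fun m => by
    let e := Fintype.equivFin φ.range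
    have := h.measure_eq _ (fun i => K (e.symm i) m) (fun i => (e.symm i : ℝ≥0∞))
      (fun i => hKc _ m) (fun i j hij => ?_) (fun i => hrange _)
    · rw [e.symm.sum_comp fun c : φ.range => (c : ℝ≥0∞) * μ (K c m)] at this
      rw [← this]
      congr 1
      ext ω
      exact e.forall_congr_left (p := fun c : φ.range =>
        ∀ x ∈ K c m, ((c : ℝ≥0∞) : EReal) ≤ w ω x)
    · refine Disjoint.mono (hKsub _ m) (hKsub _ m) (disjoint_left.2 fun x hx hx' => hij ?_)
      exact e.symm.injective (Subtype.ext (hx.symm.trans hx'))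
  have hmeas : ∀ c, Tendsto (fun m => μ (K c m)) atTop (𝓝 (μ (φ ⁻¹' {c}))) := fun c => by
    have h1 := tendsto_measure_iUnion_atTop (μ := μ) (hKmono c)
    have h2 : μ (⋃ m, K c m) = μ (φ ⁻¹' {c}) :=
      le_antisymm (measure_mono (iUnion_subset (hKsub c))) <| by
        have := measure_le_inter_add_sdiff μ (φ ⁻¹' {c}) (⋃ m, K c m)
        rw [hKnull c, add_zero] at this
        exact this.trans (measure_mono inter_subset_right)
    rwa [h2] at h1
  have hint : ∫⁻ x, φ x ∂μ = ∑ c : φ.range, (c : ℝ≥0∞) * μ (φ ⁻¹' {(c : ℝ≥0∞)}) := by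
    rw [SimpleFunc.lintegral_eq_lintegral, SimpleFunc.lintegral,
      ← Finset.sum_coe_sort φ.range fun c => c * μ (φ ⁻¹' {c})]
  have hlim : Tendsto (fun m => P (E m)) atTop (𝓝 (expNeg (∫⁻ x, φ x ∂μ))) := by
    simp only [hEP]
    refine tendsto_expNeg ?_ ?_
    · rw [hint]
      exact tendsto_finsetSum _ fun c _ =>
        ENNReal.Tendsto.const_mul (hmeas c) (Or.inr (hrange c))
    · rw [hint]
      exact ENNReal.sum_ne_top.2 fun c _ => ENNReal.mul_ne_top (hrange c) (measure_ne_top _ _)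
  have hEinf := tendsto_measure_iInter_atTop hEm hEanti ⟨0, measure_ne_top P _⟩
  -- The limit of the events imposes nothing on the null remainders of the fibres, but there `w = ⊤`
  -- almost surely.
  have heq : {ω | ∀ x, (φ x : EReal) ≤ w ω x} =ᵐ[P] ⋂ m, E m := by
    have hnull : ∀ᵐ ω ∂P, ∀ c : φ.range, ∀ x ∈ φ ⁻¹' {(c : ℝ≥0∞)} \ ⋃ m, K c m, w ω x = ⊤ :=
      ae_all_iff.2 fun c => h.ae_eq_top_of_null (hKnull c)
    filter_upwards [hnull] with ω hω
    refine propext ⟨fun hx => mem_iInter.2 fun m c x hxK => ?_, fun hx x => ?_⟩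
    · have : φ x = c := hKsub _ m hxK
      exact this ▸ hx x
    · by_cases hxK : ∃ m, x ∈ K (φ x) m
      · obtain ⟨m, hm⟩ := hxK
        exact mem_iInter.1 hx m ⟨φ x, φ.mem_range_self x⟩ x hm
      · rw [hω ⟨φ x, φ.mem_range_self x⟩ x ⟨rfl, by simpa using hxK⟩]
        exact le_top
  refine ⟨(NullMeasurableSet.iInter hEm).congr heq.symm, ?_⟩
  rw [measure_congr heq]
  exact tendsto_nhds_unique hEinf hlim

theorem HasClosedVoidProbabilities.hasVoidProbabilities
    (h : HasClosedVoidProbabilities P μ w) : HasVoidProbabilities P μ w := by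
  have key : ∀ φ : X → ℝ≥0∞, Measurable φ → ∫⁻ x, φ x ∂μ ≠ ∞ →
      NullMeasurableSet {ω | ∀ x, (φ x : EReal) ≤ w ω x} P ∧
        P {ω | ∀ x, (φ x : EReal) ≤ w ω x} = expNeg (∫⁻ x, φ x ∂μ) := by
    intro φ hφ hfin
    set E : ℕ → Set Ω := fun n => {ω | ∀ x, (SimpleFunc.eapprox φ n x : EReal) ≤ w ω x} with hE
    have hs := fun n => h.simpleFunc (SimpleFunc.eapprox φ n)
      fun x => (SimpleFunc.eapprox_lt_top φ n x).ne
    have hset : {ω | ∀ x, (φ x : EReal) ≤ w ω x} = ⋂ n, E n := by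
      ext ω
      simp only [hE, mem_ofPred_eq, mem_iInter]
      refine ⟨fun hx n x => le_trans ?_ (hx x), fun hx x => ?_⟩
      · rw [EReal.coe_ennreal_le_coe_ennreal_iff, ← SimpleFunc.iSup_eapprox_apply hφ x]
        exact le_iSup (fun n => SimpleFunc.eapprox φ n x) n
      -- The approximant with index `0` is nonnegative, hence so is `w ω x`, and the comparison can
      -- be made in `ℝ≥0∞`.
      · have h0 : 0 ≤ w ω x := le_trans (by positivity) (hx 0 x)
        rw [← EReal.coe_toENNReal h0, EReal.coe_ennreal_le_coe_ennreal_iff,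
          ← SimpleFunc.iSup_eapprox_apply hφ x]
        refine iSup_le fun n => ?_
        rw [← EReal.coe_ennreal_le_coe_ennreal_iff, EReal.coe_toENNReal h0]
        exact hx n x
    have hEanti : Antitone E := fun m n hmn ω hω x =>
      le_trans (EReal.coe_ennreal_le_coe_ennreal_iff.2 (SimpleFunc.monotone_eapprox φ hmn x)) (hω x)
    have hlim := tendsto_measure_iInter_atTop (fun n => (hs n).1) hEanti ⟨0, measure_ne_top P _⟩
    have hint : Tendsto (fun n => ∫⁻ x, SimpleFunc.eapprox φ n x ∂μ) atTop (𝓝 (∫⁻ x, φ x ∂μ)) :=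
      lintegral_tendsto_of_tendsto_of_monotone
        (fun n => (SimpleFunc.eapprox φ n).measurable.aemeasurable)
        (ae_of_all _ fun x m n hmn => SimpleFunc.monotone_eapprox φ hmn x)
        (ae_of_all _ fun x => by
          rw [← SimpleFunc.iSup_eapprox_apply hφ x]
          exact tendsto_atTop_iSup fun m n hmn => SimpleFunc.monotone_eapprox φ hmn x)
    have hlim' := tendsto_expNeg hint hfin
    rw [hset]
    refine ⟨NullMeasurableSet.iInter fun n => (hs n).1, tendsto_nhds_unique hlim ?_⟩
    convert hlim' using 2 with n
    exact (hs n).2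
  exact ⟨fun φ hφ hfin => (key φ hφ hfin).1, fun φ hφ hfin => (key φ hφ hfin).2⟩

end Extension

/-! ### Calculus of the hazard -/

/-- The cumulative hazard `∫ (t - g)⁺ dμ`. -/
noncomputable def hazard {X : Type*} [MeasurableSpace X] (μ : Measure X) (g : X → EReal) (t : ℝ) :
    ℝ≥0∞ :=
  ∫⁻ x, ((t : EReal) - g x).toENNReal ∂μ

/-- The hazard rate `μ {g ≤ s}`. -/
noncomputable def hazardRate {X : Type*} [MeasurableSpace X] (μ : Measure X) (g : X → EReal)
    (s : ℝ) : ℝ≥0∞ :=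
  μ {x | g x ≤ (s : EReal)}

/-- The probability density with hazard rate `hazardRate μ g`. -/
noncomputable def hazardDensity {X : Type*} [MeasurableSpace X] (μ : Measure X) (g : X → EReal)
    (s : ℝ) : ℝ≥0∞ :=
  hazardRate μ g s * expNeg (hazard μ g s)

theorem volume_Icc_ereal (a : EReal) (t : ℝ) :
    volume ({s : ℝ | a ≤ (s : EReal)} ∩ Iic t) = ((t : EReal) - a).toENNReal := by
  induction a with
  | bot =>
    have : ({s : ℝ | ⊥ ≤ (s : EReal)} ∩ Iic t) = Iic t := by ext; simp
    rw [this, Real.volume_Iic, EReal.sub_bot (EReal.coe_ne_bot t), EReal.toENNReal_top]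
  | top =>
    have : ({s : ℝ | ⊤ ≤ (s : EReal)} ∩ Iic t) = ∅ := by ext; simp
    rw [this, measure_empty, EReal.sub_top, EReal.toENNReal_bot]
  | coe a =>
    have : ({s : ℝ | (a : EReal) ≤ (s : EReal)} ∩ Iic t) = Icc a t := by ext; simp
    rw [this, Real.volume_Icc, ← EReal.coe_sub, EReal.real_coe_toENNReal]

theorem hazard_mono {X : Type*} [MeasurableSpace X] (μ : Measure X) (g : X → EReal) :
    Monotone (hazard μ g) := fun _ _ hst =>
  lintegral_mono fun _ => EReal.toENNReal_le_toENNReal <|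
    EReal.sub_le_sub (EReal.coe_le_coe_iff.2 hst) le_rfl

theorem hazardRate_mono {X : Type*} [MeasurableSpace X] (μ : Measure X) (g : X → EReal) :
    Monotone (hazardRate μ g) := fun _ _ hst =>
  measure_mono fun _ hx => le_trans hx (EReal.coe_le_coe_iff.2 hst)

theorem measurable_expNeg : Measurable expNeg :=
  ENNReal.measurable_ofReal.comp (Real.measurable_exp.comp ENNReal.measurable_toReal.neg)

theorem measurable_hazardDensity {X : Type*} [MeasurableSpace X] (μ : Measure X) (g : X → EReal) :
    Measurable (hazardDensity μ g) :=
  (hazardRate_mono μ g).measurable.mul (measurable_expNeg.comp (hazard_mono μ g).measurable)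

theorem measurable_toENNReal_sub {X : Type*} [MeasurableSpace X] {g : X → EReal}
    (hg : Measurable g) (t : ℝ) : Measurable fun x => ((t : EReal) - g x).toENNReal := by
  simp only [sub_eq_add_neg]
  exact ((hg.neg).const_add _).ereal_toENNReal

section

variable {X : Type*} [MeasurableSpace X] {μ : Measure X} {g : X → EReal} {m : ℝ}

theorem hazard_le (hm : ∀ x, (m : EReal) ≤ g x) (t : ℝ) :
    hazard μ g t ≤ ENNReal.ofReal (t - m) * μ univ := by
  rw [hazard, ← setLIntegral_univ, ← setLIntegral_const]
  refine lintegral_mono fun x => ?_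
  rw [← EReal.real_coe_toENNReal, EReal.coe_sub]
  exact EReal.toENNReal_le_toENNReal (EReal.sub_le_sub le_rfl (hm x))

theorem hazard_ne_top [IsFiniteMeasure μ] (hm : ∀ x, (m : EReal) ≤ g x) (t : ℝ) :
    hazard μ g t ≠ ∞ :=
  ((hazard_le hm t).trans_lt (ENNReal.mul_lt_top ENNReal.ofReal_lt_top (measure_lt_top _ _))).ne

theorem hazard_eq_zero (hm : ∀ x, (m : EReal) ≤ g x) {t : ℝ} (ht : t ≤ m) : hazard μ g t = 0 :=
  le_antisymm ((hazard_le hm t).trans (by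
    rw [ENNReal.ofReal_of_nonpos (sub_nonpos.2 ht), zero_mul])) zero_le

/-- Tonelli, with `(t - g x)⁺` read as the length of `{s ≤ t | g x ≤ s}`. -/
theorem hazard_eq_lintegral [SFinite μ] (hg : Measurable g) (t : ℝ) :
    hazard μ g t = ∫⁻ s in Iic t, hazardRate μ g s := by
  have hS : MeasurableSet {p : X × ℝ | g p.1 ≤ (p.2 : EReal)} :=
    measurableSet_le (hg.comp measurable_fst) (measurable_coe_real_ereal.comp measurable_snd)
  have h1 : ∀ x, ((t : EReal) - g x).toENNReal
      = ∫⁻ s in Iic t, {p : X × ℝ | g p.1 ≤ (p.2 : EReal)}.indicator 1 (x, s) := fun x => by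
    have hSx : MeasurableSet {s : ℝ | g x ≤ (s : EReal)} :=
      measurableSet_le measurable_const measurable_coe_real_ereal
    rw [← volume_Icc_ereal, ← Measure.restrict_apply hSx, ← lintegral_indicator_one hSx]
    rfl
  simp only [hazard, h1]
  rw [lintegral_lintegral_swap (f := fun x s => {p : X × ℝ | g p.1 ≤ (p.2 : EReal)}.indicator 1 (x, s))
    (measurable_one.indicator hS).aemeasurable]
  refine lintegral_congr fun s => ?_
  rw [hazardRate, ← lintegral_indicator_one (measurableSet_le hg measurable_const)]
  rfl

theorem hazardRate_ne_top [IsFiniteMeasure μ] (s : ℝ) : hazardRate μ g s ≠ ∞ := measure_ne_top _ _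

theorem monotone_toReal_hazardRate [IsFiniteMeasure μ] :
    Monotone fun s => (hazardRate μ g s).toReal := fun _ _ hst =>
  ENNReal.toReal_mono (hazardRate_ne_top _) (hazardRate_mono μ g hst)

theorem toReal_hazard_sub [IsFiniteMeasure μ] (hg : Measurable g) (hm : ∀ x, (m : EReal) ≤ g x)
    {a b : ℝ} (hab : a ≤ b) :
    (hazard μ g b).toReal = (hazard μ g a).toReal + ∫ s in a..b, (hazardRate μ g s).toReal := by
  have h1 : hazard μ g b = hazard μ g a + ∫⁻ s in Ioc a b, hazardRate μ g s := by
    rw [hazard_eq_lintegral hg, hazard_eq_lintegral hg, ← lintegral_union measurableSet_Ioc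
      (Iic_disjoint_Ioc le_rfl), Iic_union_Ioc_eq_Iic hab]
  have h2 : ∫⁻ s in Ioc a b, hazardRate μ g s ≠ ∞ := fun h => by
    rw [h, add_top] at h1
    exact hazard_ne_top hm b h1
  rw [h1, ENNReal.toReal_add (hazard_ne_top hm a) h2, intervalIntegral.integral_of_le hab,
    integral_toReal (hazardRate_mono μ g).measurable.aemeasurable
      (ae_of_all _ fun s => (hazardRate_ne_top s).lt_top)]

theorem continuousWithinAt_hazardRate [IsFiniteMeasure μ] (hg : Measurable g) (t : ℝ) :
    ContinuousWithinAt (fun s => (hazardRate μ g s).toReal) (Ioi t) t := by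
  have h := tendsto_measure_biInter_gt (μ := μ) (s := fun s : ℝ => {x | g x ≤ (s : EReal)}) (a := t)
    (fun s _ => (measurableSet_le hg measurable_const).nullMeasurableSet)
    (fun i j _ hij x hx => le_trans hx (EReal.coe_le_coe_iff.2 hij))
    ⟨t + 1, by simp, measure_ne_top _ _⟩
  have hset : (⋂ r : ℝ, ⋂ (_ : r > t), {x | g x ≤ (r : EReal)}) = {x | g x ≤ (t : EReal)} := by
    ext x
    simp only [mem_iInter, mem_ofPred_eq]
    refine ⟨fun h => ?_, fun h r hr => h.trans (EReal.coe_le_coe_iff.2 hr.le)⟩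
    refine le_of_forall_gt fun c hc => ?_
    obtain ⟨r, hr, hrc⟩ := EReal.lt_iff_exists_real_btwn.1 hc
    exact (h r (EReal.coe_lt_coe_iff.1 hr)).trans_lt hrc
  rw [hset] at h
  exact (ENNReal.tendsto_toReal (measure_ne_top μ _)).comp h

/-- The rate is monotone and right-continuous but may jump, so only a right derivative is available;
the fundamental theorem of calculus used for `hazardDensity` asks for no more. -/
theorem hasDerivWithinAt_hazard [IsFiniteMeasure μ] (hg : Measurable g)
    (hm : ∀ x, (m : EReal) ≤ g x) (t : ℝ) :
    HasDerivWithinAt (fun s => (hazard μ g s).toReal) (hazardRate μ g t).toReal (Ioi t) t := by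
  have h1 : HasDerivWithinAt (fun u => ∫ s in t..u, (hazardRate μ g s).toReal)
      (hazardRate μ g t).toReal (Ici t) t :=
    intervalIntegral.integral_hasDerivWithinAt_right
      (monotone_toReal_hazardRate.intervalIntegrable) (s := Ici t) (t := Ioi t)
      (monotone_toReal_hazardRate.measurable.stronglyMeasurable.stronglyMeasurableAtFilter)
      (continuousWithinAt_hazardRate hg t)
  refine ((h1.mono Ioi_subset_Ici_self).const_add (hazard μ g t).toReal).congr (fun s hs => ?_) ?_
  · exact toReal_hazard_sub hg hm (le_of_lt hs)
  · exact toReal_hazard_sub hg hm le_rfl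

theorem continuous_toReal_hazard [IsFiniteMeasure μ] (hg : Measurable g)
    (hm : ∀ x, (m : EReal) ≤ g x) : Continuous fun s => (hazard μ g s).toReal := by
  rw [continuous_iff_continuousAt]
  intro t
  have h1 : Continuous fun u => ∫ s in (t - 1)..u, (hazardRate μ g s).toReal :=
    intervalIntegral.continuous_primitive
      (fun a b => monotone_toReal_hazardRate.intervalIntegrable) (t - 1)
  refine ((continuous_const (y := (hazard μ g (t - 1)).toReal)).add h1).continuousAt.congr ?_
  filter_upwards [Ioi_mem_nhds (sub_one_lt t)] with s hs
  exact (toReal_hazard_sub hg hm (le_of_lt hs)).symm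

theorem setLIntegral_Ico_hazardDensity [IsFiniteMeasure μ] (hg : Measurable g)
    (hm : ∀ x, (m : EReal) ≤ g x) {a b : ℝ} (hab : a ≤ b) :
    ∫⁻ s in Ico a b, hazardDensity μ g s = expNeg (hazard μ g a) - expNeg (hazard μ g b) := by
  set L : ℝ → ℝ := fun s => (hazard μ g s).toReal with hL
  set h : ℝ → ℝ := fun s => (hazardRate μ g s).toReal with hh
  have hcont : Continuous fun s => Real.exp (-L s) :=
    Real.continuous_exp.comp (continuous_toReal_hazard hg hm).neg
  have hint : IntervalIntegrable (fun s => h s * Real.exp (-L s)) volume a b :=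
    monotone_toReal_hazardRate.intervalIntegrable.mul_continuousOn hcont.continuousOn
  have hftc : ∫ s in a..b, h s * Real.exp (-L s) = -Real.exp (-L b) - -Real.exp (-L a) := by
    refine intervalIntegral.integral_eq_sub_of_hasDeriv_right_of_le
      (f := fun s => -Real.exp (-L s)) hab hcont.neg.continuousOn (fun s _ => ?_) hint
    have h1 : HasDerivWithinAt (fun s => -Real.exp (-L s)) (-(Real.exp (-L s) * -h s)) (Ioi s) s :=
      (hasDerivWithinAt_hazard (μ := μ) hg hm s).neg.exp.neg
    have h2 : h s * Real.exp (-L s) = -(Real.exp (-L s) * -h s) := by ring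
    rw [h2]
    exact h1
  have hden : ∀ s, hazardDensity μ g s = ENNReal.ofReal (h s * Real.exp (-L s)) := fun s => by
    rw [hazardDensity, expNeg, ENNReal.ofReal_mul ENNReal.toReal_nonneg,
      ENNReal.ofReal_toReal (hazardRate_ne_top s)]
  rw [restrict_Ico_eq_restrict_Ioc]
  simp only [hden]
  rw [← ofReal_integral_eq_lintegral_ofReal hint.1
    (ae_of_all _ fun s => mul_nonneg ENNReal.toReal_nonneg (Real.exp_nonneg _)),
    ← intervalIntegral.integral_of_le hab, hftc, expNeg, expNeg,
    ← ENNReal.ofReal_sub _ (Real.exp_nonneg _)]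
  congr 1
  ring

/-- Some sublevel set `{g ≤ N}` has positive mass, and over it the hazard grows at least linearly.
This is where finiteness of `g` on a non-null set enters: it makes the survival function tend to
`0`, so that no mass escapes to `+∞`. -/
theorem tendsto_hazard_atTop (hg : Measurable g) (hfin : μ {x | g x < ⊤} ≠ 0) :
    Tendsto (hazard μ g) atTop (𝓝 ∞) := by
  obtain ⟨N, hN⟩ : ∃ N : ℕ, μ {x | g x ≤ ((N : ℝ) : EReal)} ≠ 0 := by
    by_contra! hcon
    refine hfin (measure_mono_null (fun x hx => ?_) (measure_iUnion_null hcon))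
    have hx' : g x < ⊤ := hx
    obtain ⟨y, hy, -⟩ := EReal.lt_iff_exists_real_btwn.1 hx'
    obtain ⟨n, hn⟩ := exists_nat_gt y
    exact mem_iUnion.2 ⟨n, hy.le.trans (EReal.coe_le_coe_iff.2 hn.le)⟩
  set c := μ {x | g x ≤ ((N : ℝ) : EReal)} with hc
  have hle : ∀ t : ℝ, ENNReal.ofReal (t - N) * c ≤ hazard μ g t := fun t => by
    rw [hc, ← setLIntegral_const]
    refine le_trans (setLIntegral_mono' (measurableSet_le hg measurable_const) fun x hx => ?_)
      (setLIntegral_le_lintegral {x | g x ≤ ((N : ℝ) : EReal)} _)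
    rw [← EReal.real_coe_toENNReal, EReal.coe_sub]
    exact EReal.toENNReal_le_toENNReal (EReal.sub_le_sub le_rfl hx)
  refine tendsto_nhds_top_mono' ?_ hle
  have h1 : Tendsto (fun t : ℝ => ENNReal.ofReal (t - N)) atTop (𝓝 ∞) :=
    ENNReal.tendsto_ofReal_atTop.comp (tendsto_atTop_add_const_right _ _ tendsto_id)
  have := ENNReal.Tendsto.mul_const (b := c) h1 (Or.inl ENNReal.top_ne_zero)
  rwa [ENNReal.top_mul hN] at this

theorem tendsto_expNeg_hazard_atTop [IsFiniteMeasure μ] (hg : Measurable g)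
    (hm : ∀ x, (m : EReal) ≤ g x) (hfin : μ {x | g x < ⊤} ≠ 0) :
    Tendsto (fun t => expNeg (hazard μ g t)) atTop (𝓝 0) := by
  rw [← ENNReal.ofReal_zero]
  refine ENNReal.tendsto_ofReal (Real.tendsto_exp_neg_atTop_nhds_zero.comp ?_)
  rw [tendsto_atTop]
  intro b
  filter_upwards [(tendsto_hazard_atTop hg hfin).eventually
    (lt_mem_nhds (ENNReal.ofReal_lt_top (r := b)))] with t ht
  exact (ENNReal.ofReal_le_iff_le_toReal (hazard_ne_top hm t)).1 ht.le

theorem setLIntegral_Ioi_hazardDensity [IsFiniteMeasure μ] (hg : Measurable g)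
    (hm : ∀ x, (m : EReal) ≤ g x) (hfin : μ {x | g x < ⊤} ≠ 0) (a : ℝ) :
    ∫⁻ s in Ioi a, hazardDensity μ g s = expNeg (hazard μ g a) := by
  rw [Measure.restrict_congr_set Ioi_ae_eq_Ici]
  have h1 := (aecover_Ici_of_Ico (μ := volume) (B := a) (tendsto_id (α := ℝ)
    (x := atTop))).lintegral_tendsto_of_countably_generated
    (f := hazardDensity μ g) (measurable_hazardDensity μ g).aemeasurable
  refine tendsto_nhds_unique h1 ?_
  have h2 : Tendsto (fun b => expNeg (hazard μ g a) - expNeg (hazard μ g b)) atTop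
      (𝓝 (expNeg (hazard μ g a) - 0)) :=
    ENNReal.Tendsto.sub tendsto_const_nhds (tendsto_expNeg_hazard_atTop hg hm hfin)
      (Or.inl (expNeg_ne_top _))
  rw [tsub_zero] at h2
  refine h2.congr' ?_
  filter_upwards [eventually_ge_atTop a] with b hb
  rw [Measure.restrict_restrict measurableSet_Ico, inter_eq_left.2 (fun x hx => hx.1),
    ← setLIntegral_Ico_hazardDensity hg hm hb]
  rfl

theorem hazardRate_eq_zero (hm : ∀ x, (m : EReal) ≤ g x) {s : ℝ} (hs : s < m) :
    hazardRate μ g s = 0 := by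
  have : {x | g x ≤ (s : EReal)} = ∅ := by
    ext x
    simpa using (EReal.coe_lt_coe_iff.2 hs).trans_le (hm x)
  rw [hazardRate, this, measure_empty]

theorem lintegral_hazardDensity [IsFiniteMeasure μ] (hg : Measurable g)
    (hm : ∀ x, (m : EReal) ≤ g x) (hfin : μ {x | g x < ⊤} ≠ 0) :
    ∫⁻ s, hazardDensity μ g s = 1 := by
  rw [← expNeg_zero, ← hazard_eq_zero (μ := μ) hm (sub_one_lt m).le,
    ← setLIntegral_Ioi_hazardDensity hg hm hfin, ← lintegral_indicator measurableSet_Ioi]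
  refine lintegral_congr fun s => ?_
  by_cases hs : m - 1 < s
  · rw [indicator_of_mem (by exact hs)]
  · rw [indicator_of_notMem (by exact hs), hazardDensity, hazardRate_eq_zero hm (by linarith),
      zero_mul]

theorem toENNReal_sub_shiftPos {X : Type*} {g : X → EReal}
    (hbot : ∀ x, g x ≠ ⊥) (r u : ℝ) (hu : 0 ≤ u) (x : X) :
    ((u : EReal) - shiftPos g r x).toENNReal + ((r : EReal) - g x).toENNReal
      = (((r + u : ℝ) : EReal) - g x).toENNReal := by
  rw [shiftPos]
  have hb := hbot x
  generalize g x = a at hb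
  induction a with
  | bot => exact absurd rfl hb
  | top =>
    rw [EReal.top_sub_coe, max_eq_left le_top, EReal.sub_top, EReal.sub_top,
      EReal.sub_top]
    simp
  | coe a =>
    have h0 : (0 : EReal) = ((0 : ℝ) : EReal) := rfl
    rw [← EReal.coe_sub, h0, ← EReal.coe_strictMono.monotone.map_max, ← EReal.coe_sub,
      ← EReal.coe_sub, ← EReal.coe_sub,
      EReal.real_coe_toENNReal, EReal.real_coe_toENNReal, EReal.real_coe_toENNReal]
    rcases le_total a r with h | h
    · rw [max_eq_right (by linarith), ← ENNReal.ofReal_add (by linarith) (by linarith)]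
      congr 1
      ring
    · rw [max_eq_left (by linarith), ENNReal.ofReal_of_nonpos (p := r - a) (by linarith), add_zero]
      congr 1
      ring

/-- Additivity of the hazard under restarting at level `r`: after `r`, the landscape seen is `(g -
r)⁺`. This is the source of the telescoping of the kernels. -/
theorem hazard_shiftPos (hg : Measurable g) (hbot : ∀ x, g x ≠ ⊥) (r u : ℝ) (hu : 0 ≤ u) :
    hazard μ (shiftPos g r) u + hazard μ g r = hazard μ g (r + u) := by
  rw [hazard, hazard, hazard, ← lintegral_add_right _ (measurable_toENNReal_sub hg r)]
  exact lintegral_congr fun x => toENNReal_sub_shiftPos hbot r u hu x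

theorem measurable_shiftPos (hg : Measurable g) (r : ℝ) : Measurable (shiftPos g r) := by
  have : shiftPos g r = fun x => max (g x + -(r : EReal)) 0 := by
    ext x; rw [shiftPos, sub_eq_add_neg]
  rw [this]
  exact (hg.add_const _).max measurable_const

theorem zero_le_shiftPos {X : Type*} (g : X → EReal) (r : ℝ) (x : X) :
    ((0 : ℝ) : EReal) ≤ shiftPos g r x := le_max_right _ _

end

/-- The normalization of `μ_λ` cancels against the total rate, which leaves the integral of the
hazard rate. -/
theorem ofReal_survival {X : Type*} [MeasureSpace X] {lam : X → ℝ}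
    (hlam : Integrable lam) (hpos : ∀ x, 0 < lam x) {h : X → EReal} (hh : Measurable h) (t : ℝ) :
    ENNReal.ofReal (survival lam h t)
      = expNeg (hazard (volume.withDensity fun x => ENNReal.ofReal (lam x)) h t) := by
  set μ : Measure X := volume.withDensity fun x => ENNReal.ofReal (lam x) with hμ
  have hC : ENNReal.ofReal (totalRate lam) = μ univ := by
    rw [totalRate, ← setIntegral_univ, ofReal_setIntegral_eq_withDensity hlam hpos .univ]
  have : IsFiniteMeasure μ := ⟨by rw [← hC]; exact ENNReal.ofReal_lt_top⟩
  have hC0 : 0 ≤ totalRate lam := integral_nonneg fun x => (hpos x).le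
  have hcum : ∀ s, totalRate lam * cumul lam h s = (hazardRate μ h s).toReal := fun s => by
    -- If the total rate is `0` there is nothing to cancel, but then `μ` vanishes and both sides are
    -- `0`.
    rcases hC0.eq_or_lt with h0 | h0
    · have : μ univ = 0 := by rw [← hC, ← h0, ENNReal.ofReal_zero]
      rw [← h0, zero_mul, hazardRate, measure_mono_null (subset_univ _) this, ENNReal.toReal_zero]
    · rw [cumul, rateMeasure, measureReal_def, Measure.smul_apply, smul_eq_mul,
        ENNReal.toReal_mul, ENNReal.toReal_inv, ENNReal.toReal_ofReal hC0,
        mul_inv_cancel_left₀ h0.ne']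
      rfl
  rw [survival, expNeg, ← integral_const_mul, hazard_eq_lintegral hh]
  simp only [hcum]
  rw [integral_toReal (hazardRate_mono μ h).measurable.aemeasurable
      (ae_of_all _ fun s => (hazardRate_ne_top s).lt_top)]

/-! ### Integration against finite product measures -/

section PiMeasure

variable {α : Type*} [MeasurableSpace α]

theorem lintegral_pi_snoc {n : ℕ} (μ : Fin (n + 1) → Measure α) [∀ i, SigmaFinite (μ i)]
    {F : (Fin (n + 1) → α) → ℝ≥0∞} (hF : Measurable F) :
    ∫⁻ x, F x ∂(Measure.pi μ)
      = ∫⁻ y, ∫⁻ a, F (Fin.snoc y a) ∂(μ (Fin.last n)) ∂(Measure.pi fun j => μ j.castSucc) := by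
  have h1 := (measurePreserving_piFinSuccAbove μ (Fin.last n)).symm
  have h2 := h1.lintegral_comp hF
  rw [← h2, lintegral_prod_symm]
  · simp only [Fin.succAbove_last]
    refine lintegral_congr fun y => lintegral_congr fun a => ?_
    congr 1
    exact Fin.insertNth_last' a y
  · exact (hF.comp (MeasurableEquiv.measurable _)).aemeasurable

theorem lintegral_pi_prod : ∀ {n : ℕ} (μ : Fin n → Measure α) [∀ i, SigmaFinite (μ i)]
    {f : Fin n → α → ℝ≥0∞} (_ : ∀ i, Measurable (f i)),
    ∫⁻ x, ∏ j, f j (x j) ∂(Measure.pi μ) = ∏ j, ∫⁻ a, f j a ∂(μ j)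
  | 0, μ, _, f, _ => by
    simp only [Finset.univ_eq_empty, Finset.prod_empty, lintegral_const, one_mul]
    rw [Measure.pi_of_empty μ (fun a => a.elim0)]
    simp
  | n + 1, μ, _, f, hf => by
    rw [lintegral_pi_snoc μ (F := fun x => ∏ j, f j (x j)) (Finset.measurable_fun_prod _ fun j _ =>
      (hf j).comp (measurable_pi_apply j)), Fin.prod_univ_castSucc,
      ← lintegral_pi_prod (fun j => μ j.castSucc) (fun j => hf j.castSucc),
      ← lintegral_mul_const _ (Finset.measurable_fun_prod _ fun j _ =>
        (hf j.castSucc).comp (measurable_pi_apply j))]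
    refine lintegral_congr fun y => ?_
    simp only [Fin.prod_univ_castSucc, Fin.snoc_castSucc, Fin.snoc_last]
    rw [lintegral_const_mul _ (hf _)]

theorem pi_withDensity {n : ℕ} (μ : Fin n → Measure α) [∀ i, SigmaFinite (μ i)]
    {f : Fin n → α → ℝ≥0∞} (hf : ∀ i, Measurable (f i))
    [∀ i, SigmaFinite ((μ i).withDensity (f i))] :
    Measure.pi (fun i => (μ i).withDensity (f i))
      = (Measure.pi μ).withDensity (fun x => ∏ j, f j (x j)) := by
  refine (Measure.pi_eq fun s hs => ?_)
  rw [withDensity_apply _ (MeasurableSet.univ_pi hs), ← lintegral_indicator (.univ_pi hs)]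
  have h1 : ∀ x : Fin n → α, (univ.pi s).indicator (fun x => ∏ j, f j (x j)) x
      = ∏ j, (s j).indicator (f j) (x j) := fun x => by
    classical
    by_cases hx : x ∈ univ.pi s
    · rw [indicator_of_mem hx]
      exact Finset.prod_congr rfl fun j _ => (indicator_of_mem (hx j (mem_univ j)) _).symm
    · rw [indicator_of_notMem hx]
      simp only [mem_univ_pi, not_forall] at hx
      obtain ⟨j, hj⟩ := hx
      exact (Finset.prod_eq_zero (Finset.mem_univ j) (indicator_of_notMem hj _)).symm
  simp only [h1]
  rw [lintegral_pi_prod μ fun j => (hf j).indicator (hs j)]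
  exact Finset.prod_congr rfl fun j _ => by
    rw [lintegral_indicator (hs j), withDensity_apply _ (hs j)]

end PiMeasure

/-! ### Laws of the minima of `w + g` over boxes -/

theorem toENNReal_sub_le_iff {t : ℝ} {a w : EReal} (ha : a ≠ ⊥) (hw : 0 ≤ w) :
    (((t : EReal) - a).toENNReal : EReal) ≤ w ↔ (t : EReal) ≤ w + a := by
  rw [EReal.coe_toENNReal_eq_max, max_le_iff, and_iff_right hw]
  have hw' : w ≠ ⊥ := fun h => by simp [h] at hw
  induction a with
  | bot => exact absurd rfl ha
  | top => simp [EReal.add_top_of_ne_bot hw', EReal.sub_top]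
  | coe a =>
    exact EReal.sub_le_iff_le_add (Or.inl (EReal.coe_ne_bot a)) (Or.inl (EReal.coe_ne_top a))

section Boxes

variable {X : Type*} [MeasurableSpace X] {Ω : Type*} [MeasurableSpace Ω] {P : Measure Ω}
  [IsProbabilityMeasure P] {μ : Measure X} {w : Ω → X → EReal} {g : X → EReal}
  {m : ℝ}

theorem HasVoidProbabilities.ae_nonneg (h : HasVoidProbabilities P μ w) :
    ∀ᵐ ω ∂P, ∀ x, 0 ≤ w ω x := by
  have h1 := h.measure_eq 0 measurable_const (by simp)
  have h2 := h.nullMeasurableSet 0 measurable_const (by simp)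
  simp only [Pi.zero_apply, lintegral_zero, expNeg_zero, EReal.coe_ennreal_zero] at h1 h2
  exact (mem_ae_iff_prob_eq_one₀ h2).2 h1

/-- The infimum of `w + g` over `B`. -/
noncomputable def boxMin (w : Ω → X → EReal) (g : X → EReal) (B : Set X) (ω : Ω) : EReal :=
  infOn (fun x => w ω x + g x) B

variable [IsFiniteMeasure μ]

/-- All the lower bounds together say that `w` lies above the single function equal to `(t i - g)⁺`
on `B i` and to `0` elsewhere, so one void probability gives the joint survival function. -/
theorem HasVoidProbabilities.boxMin_joint (h : HasVoidProbabilities P μ w) (hg : Measurable g)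
    (hm : ∀ x, (m : EReal) ≤ g x) {ι : Type*} [Fintype ι] {B : ι → Set X}
    (hB : ∀ i, MeasurableSet (B i)) (hd : Pairwise (Function.onFun Disjoint B)) (t : ι → ℝ) :
    NullMeasurableSet {ω | ∀ i, (t i : EReal) ≤ boxMin w g (B i) ω} P ∧
      P {ω | ∀ i, (t i : EReal) ≤ boxMin w g (B i) ω}
        = expNeg (∑ i, hazard (μ.restrict (B i)) g (t i)) := by
  classical
  have hbot : ∀ x, g x ≠ ⊥ := fun x hx => by simpa [hx] using hm x
  set φ : X → ℝ≥0∞ := fun x => ∑ i, (B i).indicator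
    (fun x => ((t i : EReal) - g x).toENNReal) x with hφ
  have hφm : Measurable φ := Finset.measurable_fun_sum _ fun i _ =>
    (measurable_toENNReal_sub hg (t i)).indicator (hB i)
  have hφint : ∫⁻ x, φ x ∂μ = ∑ i, hazard (μ.restrict (B i)) g (t i) := by
    rw [lintegral_finsetSum _ fun i _ => (measurable_toENNReal_sub hg (t i)).indicator (hB i)]
    exact Finset.sum_congr rfl fun i _ => lintegral_indicator (hB i) _
  have hfin : ∫⁻ x, φ x ∂μ ≠ ∞ := by
    rw [hφint]
    exact ENNReal.sum_ne_top.2 fun i _ => hazard_ne_top hm _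
  have hφB : ∀ i, ∀ x ∈ B i, φ x = ((t i : EReal) - g x).toENNReal := fun i x hx => by
    rw [hφ]
    dsimp only
    rw [Finset.sum_eq_single i, indicator_of_mem hx]
    · exact fun j _ hj => indicator_of_notMem (fun hxj => disjoint_left.1 (hd hj) hxj hx) _
    · simp
  -- The two events agree only where `w ≥ 0`, which holds almost surely (the void probability of `φ
  -- = 0`).
  have heq : {ω | ∀ x, (φ x : EReal) ≤ w ω x}
      =ᵐ[P] {ω | ∀ i, (t i : EReal) ≤ boxMin w g (B i) ω} := by
    filter_upwards [h.ae_nonneg] with ω hω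
    refine propext ⟨fun hx i => le_infOn_iff.2 fun x hxi => ?_, fun hx x => ?_⟩
    · rw [← toENNReal_sub_le_iff (hbot x) (hω x), ← hφB i x hxi]
      exact hx x
    · by_cases hxi : ∃ i, x ∈ B i
      · obtain ⟨i, hi⟩ := hxi
        rw [hφB i x hi, toENNReal_sub_le_iff (hbot x) (hω x)]
        exact le_infOn_iff.1 (hx i) x hi
      · have h0 : φ x = 0 := Finset.sum_eq_zero fun i _ =>
          indicator_of_notMem (fun hi => hxi ⟨i, hi⟩) _
        rw [h0]
        exact hω x
  refine ⟨(h.nullMeasurableSet φ hφm hfin).congr heq, ?_⟩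
  rw [← measure_congr heq, h.measure_eq φ hφm hfin, hφint]

theorem HasVoidProbabilities.boxMin_single (h : HasVoidProbabilities P μ w) (hg : Measurable g)
    (hm : ∀ x, (m : EReal) ≤ g x) {B : Set X} (hB : MeasurableSet B) (t : ℝ) :
    NullMeasurableSet {ω | (t : EReal) ≤ boxMin w g B ω} P ∧
      P {ω | (t : EReal) ≤ boxMin w g B ω} = expNeg (hazard (μ.restrict B) g t) := by
  have := h.boxMin_joint hg hm (ι := Unit) (B := fun _ => B) (fun _ => hB)
    (fun i j hij => (hij rfl).elim) (fun _ => t)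
  simpa using this

theorem aemeasurable_of_nullMeasurableSet_le {Ω : Type*} [MeasurableSpace Ω] {P : Measure Ω}
    {Y : Ω → EReal}
    (hY : ∀ t : ℝ, NullMeasurableSet {ω | (t : EReal) ≤ Y ω} P) : AEMeasurable Y P := by
  refine NullMeasurable.aemeasurable ?_
  have : @Measurable (NullMeasurableSpace Ω P) EReal _ _ Y := by
    refine measurable_of_Ici fun x => ?_
    induction x with
    | bot => rw [Ici_bot]; exact MeasurableSet.univ
    | coe t => exact hY t
    | top =>
      have hset : Y ⁻¹' Ici ⊤ = ⋂ n : ℕ, {ω | ((n : ℝ) : EReal) ≤ Y ω} := by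
        ext ω
        simp only [mem_preimage, mem_Ici, top_le_iff, mem_iInter, mem_ofPred_eq]
        refine ⟨fun hω n => hω ▸ le_top, fun hω => (EReal.eq_top_iff_forall_lt _).2 fun y => ?_⟩
        obtain ⟨n, hn⟩ := exists_nat_gt y
        exact (EReal.coe_lt_coe_iff.2 hn).trans_le (hω n)
      change NullMeasurableSet (Y ⁻¹' Ici ⊤) P
      rw [hset]
      exact NullMeasurableSet.iInter fun n => hY n
  exact this

theorem HasVoidProbabilities.aemeasurable_boxMin (h : HasVoidProbabilities P μ w)
    (hg : Measurable g) (hm : ∀ x, (m : EReal) ≤ g x) {B : Set X} (hB : MeasurableSet B) :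
    AEMeasurable (boxMin w g B) P :=
  aemeasurable_of_nullMeasurableSet_le fun t => (h.boxMin_single hg hm hB t).1

theorem HasVoidProbabilities.map_boxMin_Ici (h : HasVoidProbabilities P μ w)
    (hg : Measurable g) (hm : ∀ x, (m : EReal) ≤ g x) {B : Set X} (hB : MeasurableSet B) (t : ℝ) :
    P.map (boxMin w g B) (Ici (t : EReal)) = expNeg (hazard (μ.restrict B) g t) := by
  rw [Measure.map_apply_of_aemeasurable (h.aemeasurable_boxMin hg hm hB) measurableSet_Ici]
  exact (h.boxMin_single hg hm hB t).2

theorem measurableEmbedding_coe_ereal : MeasurableEmbedding ((↑) : ℝ → EReal) :=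
  EReal.isOpenEmbedding_coe.measurableEmbedding

theorem image_coe_Ico_ereal (a b : ℝ) :
    ((↑) : ℝ → EReal) '' Ico a b = Ici (a : EReal) \ Ici (b : EReal) := by
  ext x
  induction x with
  | bot => simp
  | top => simp
  | coe x => simp

/-- The law may also have an atom at `⊤`, for instance when `g = ⊤` on `B`, so only its part on the
reals has a density. It is identified on half-open intervals. -/
theorem HasVoidProbabilities.comap_map_boxMin (h : HasVoidProbabilities P μ w)
    (hg : Measurable g) (hm : ∀ x, (m : EReal) ≤ g x) {B : Set X} (hB : MeasurableSet B) :
    (P.map (boxMin w g B)).comap ((↑) : ℝ → EReal)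
      = volume.withDensity (hazardDensity (μ.restrict B) g) := by
  have hY := h.aemeasurable_boxMin hg hm hB
  have : IsProbabilityMeasure (P.map (boxMin w g B)) := Measure.isProbabilityMeasure_map hY
  have : IsFiniteMeasure ((P.map (boxMin w g B)).comap ((↑) : ℝ → EReal)) :=
    ⟨by rw [measurableEmbedding_coe_ereal.comap_apply]; exact measure_lt_top _ _⟩
  refine Measure.ext_of_Ico _ _ fun a b hab => ?_
  rw [measurableEmbedding_coe_ereal.comap_apply, image_coe_Ico_ereal,
    measure_sdiff (Ici_subset_Ici.2 (EReal.coe_le_coe_iff.2 hab.le))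
      measurableSet_Ici.nullMeasurableSet (measure_ne_top _ _),
    h.map_boxMin_Ici hg hm hB, h.map_boxMin_Ici hg hm hB, withDensity_apply _ measurableSet_Ico,
    setLIntegral_Ico_hazardDensity hg hm hab.le]

theorem HasVoidProbabilities.map_boxMin_singleton (h : HasVoidProbabilities P μ w)
    (hg : Measurable g) (hm : ∀ x, (m : EReal) ≤ g x) {B : Set X} (hB : MeasurableSet B) (t : ℝ) :
    P.map (boxMin w g B) {(t : EReal)} = 0 := by
  rw [← image_singleton (f := ((↑) : ℝ → EReal)), ← measurableEmbedding_coe_ereal.comap_apply,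
    h.comap_map_boxMin hg hm hB]
  exact withDensity_absolutelyContinuous _ _ (measure_singleton t)

theorem HasVoidProbabilities.map_boxMin_Ioi (h : HasVoidProbabilities P μ w)
    (hg : Measurable g) (hm : ∀ x, (m : EReal) ≤ g x) {B : Set X} (hB : MeasurableSet B) (t : ℝ) :
    P.map (boxMin w g B) (Ioi (t : EReal)) = expNeg (hazard (μ.restrict B) g t) := by
  rw [← h.map_boxMin_Ici hg hm hB, ← Ici_sdiff_left,
    measure_sdiff_null (h.map_boxMin_singleton hg hm hB t)]

theorem generateFrom_Ici_real_ereal :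
    MeasurableSpace.generateFrom (insert univ (range fun t : ℝ => Ici (t : EReal)))
      = (inferInstance : MeasurableSpace EReal) := by
  refine le_antisymm (MeasurableSpace.generateFrom_le ?_) ?_
  · rintro s (rfl | ⟨t, rfl⟩)
    · exact .univ
    · exact measurableSet_Ici
  · rw [BorelSpace.measurable_eq (α := EReal), borel_eq_generateFrom_Ici]
    refine MeasurableSpace.generateFrom_le ?_
    have hreal : ∀ t : ℝ, MeasurableSet[MeasurableSpace.generateFrom
        (insert univ (range fun t : ℝ => Ici (t : EReal)))] (Ici (t : EReal)) := fun t =>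
      MeasurableSpace.measurableSet_generateFrom (mem_insert_of_mem _ (mem_range_self t))
    rintro _ ⟨x, rfl⟩
    induction x with
    | bot => rw [Ici_bot]; exact @MeasurableSet.univ _ (_)
    | coe t => exact hreal t
    | top =>
      have hset : Ici (⊤ : EReal) = ⋂ n : ℕ, Ici (((n : ℝ)) : EReal) := by
        ext x
        simp only [mem_Ici, top_le_iff, mem_iInter]
        refine ⟨fun hx n => hx ▸ le_top, fun hx => (EReal.eq_top_iff_forall_lt _).2 fun y => ?_⟩
        obtain ⟨n, hn⟩ := exists_nat_gt y
        exact (EReal.coe_lt_coe_iff.2 hn).trans_le (hx n)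
      rw [hset]
      exact MeasurableSet.iInter fun n => hreal n

theorem isPiSystem_Ici_real_ereal :
    IsPiSystem (insert univ (range fun t : ℝ => Ici (t : EReal))) := by
  rintro s (rfl | ⟨a, rfl⟩) t (rfl | ⟨b, rfl⟩) -
  · exact mem_insert_iff.2 (Or.inl (inter_univ _))
  · exact mem_insert_iff.2 (Or.inr ⟨b, (univ_inter _).symm⟩)
  · exact mem_insert_iff.2 (Or.inr ⟨a, (inter_univ _).symm⟩)
  · refine mem_insert_iff.2 (Or.inr ⟨max a b, ?_⟩)
    dsimp only
    rw [Ici_inter_Ici, EReal.coe_strictMono.monotone.map_max]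

/-- The joint survival function factorizes, and half-lines with real endpoints form a generating
π-system. -/
theorem HasVoidProbabilities.map_boxMin_eq_pi (h : HasVoidProbabilities P μ w)
    (hg : Measurable g) (hm : ∀ x, (m : EReal) ≤ g x) {ι : Type*} [Fintype ι] {B : ι → Set X}
    (hB : ∀ i, MeasurableSet (B i)) (hd : Pairwise (Function.onFun Disjoint B)) :
    P.map (fun ω i => boxMin w g (B i) ω) = Measure.pi fun i => P.map (boxMin w g (B i)) := by
  have hY := fun i => h.aemeasurable_boxMin hg hm (hB i)
  have hL : ∀ i, IsProbabilityMeasure (P.map (boxMin w g (B i))) := fun i =>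
    Measure.isProbabilityMeasure_map (hY i)
  refine (Measure.pi_eq_generateFrom (fun _ => generateFrom_Ici_real_ereal)
    (fun _ => isPiSystem_Ici_real_ereal)
    (fun i => ⟨fun _ => univ, fun _ => mem_insert _ _, fun _ => measure_lt_top _ _,
      iUnion_const _⟩) fun s hs => ?_).symm
  have hlow : ∀ i, ∀ᵐ ω ∂P, (m : EReal) ≤ boxMin w g (B i) ω := fun i => by
    obtain ⟨h1, h2⟩ := h.boxMin_single hg hm (hB i) m
    rw [hazard_eq_zero hm le_rfl, expNeg_zero] at h2
    exact (mem_ae_iff_prob_eq_one₀ h1).2 h2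
  -- The member `univ` of the π-system can also be replaced by a half-line: the box minima are
  -- almost surely at least `m`.
  have hex : ∀ i, ∃ t : ℝ, ∀ᵐ ω ∂P, boxMin w g (B i) ω ∈ s i ↔ (t : EReal) ≤ boxMin w g (B i) ω := by
    intro i
    rcases hs i with hi | ⟨t, hi⟩
    · refine ⟨m, ?_⟩
      filter_upwards [hlow i] with ω hω
      simp [hi, hω]
    · exact ⟨t, ae_of_all _ fun ω => by rw [← hi, mem_Ici]⟩
  choose t ht using hex
  have hsm : ∀ i, MeasurableSet (s i) := fun i => by
    rcases hs i with hi | ⟨t, hi⟩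
    · exact hi ▸ .univ
    · exact hi ▸ measurableSet_Ici
  rw [Measure.map_apply_of_aemeasurable (aemeasurable_pi_lambda _ hY) (.univ_pi hsm)]
  have hset : (fun ω i => boxMin w g (B i) ω) ⁻¹' univ.pi s
      =ᵐ[P] {ω | ∀ i, (t i : EReal) ≤ boxMin w g (B i) ω} := by
    filter_upwards [ae_all_iff.2 ht] with ω hω
    refine propext ⟨fun hx i => (hω i).1 (hx i (mem_univ i)), fun hx i _ => (hω i).2 (hx i)⟩
  rw [measure_congr hset, (h.boxMin_joint hg hm hB hd t).2,
    expNeg_sum _ fun i _ => hazard_ne_top hm _]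
  refine Finset.prod_congr rfl fun i _ => ?_
  rw [Measure.map_apply_of_aemeasurable (hY i) (hsm i), ← (h.boxMin_single hg hm (hB i) (t i)).2]
  exact (measure_congr ((ht i).mono fun ω hω => propext hω)).symm

/-- Two independent variables without real atoms almost surely share no real value. Both may still
be `⊤`. -/
theorem HasVoidProbabilities.ae_boxMin_ne (h : HasVoidProbabilities P μ w)
    (hg : Measurable g) (hm : ∀ x, (m : EReal) ≤ g x) {B C : Set X}
    (hB : MeasurableSet B) (hC : MeasurableSet C) (hd : Disjoint B C) :
    ∀ᵐ ω ∂P, boxMin w g B ω = boxMin w g C ω → ∀ t : ℝ, boxMin w g B ω ≠ t := by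
  have hYB := h.aemeasurable_boxMin hg hm hB
  have hYC := h.aemeasurable_boxMin hg hm hC
  have hLB : IsProbabilityMeasure (P.map (boxMin w g B)) := Measure.isProbabilityMeasure_map hYB
  have hLC : IsProbabilityMeasure (P.map (boxMin w g C)) := Measure.isProbabilityMeasure_map hYC
  set D : Fin 2 → Set X := ![B, C] with hD
  have hDm : ∀ i, MeasurableSet (D i) := fun i => by fin_cases i <;> assumption
  have hDd : Pairwise (Function.onFun Disjoint D) := by
    intro i j hij
    fin_cases i <;> fin_cases j
    · exact absurd rfl hij
    · exact hd
    · exact hd.symm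
    · exact absurd rfl hij
  have hmap := h.map_boxMin_eq_pi hg hm hDm hDd
  have hind : iIndepFun (fun i => boxMin w g (D i)) P :=
    (iIndepFun_iff_map_fun_eq_pi_map fun i => h.aemeasurable_boxMin hg hm (hDm i)).2 hmap
  have hind2 : IndepFun (boxMin w g B) (boxMin w g C) P :=
    hind.indepFun (i := 0) (j := 1) (by decide)
  have hprod := (indepFun_iff_map_prod_eq_prod_map_map hYB hYC).1 hind2
  set S : Set (EReal × EReal) := {p | p.1 = p.2} ∩ {p | p.1 ∈ range ((↑) : ℝ → EReal)} with hS
  have hSm : MeasurableSet S := (measurableSet_eq_fun measurable_fst measurable_snd).inter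
    (measurable_fst measurableEmbedding_coe_ereal.measurableSet_range)
  have h0 : P ((fun ω => (boxMin w g B ω, boxMin w g C ω)) ⁻¹' S) = 0 := by
    rw [← Measure.map_apply_of_aemeasurable (hYB.prodMk hYC) hSm, hprod, Measure.prod_apply hSm]
    refine (lintegral_congr fun y => ?_).trans lintegral_zero
    by_cases hy : y ∈ range ((↑) : ℝ → EReal)
    · obtain ⟨t, rfl⟩ := hy
      refine measure_mono_null (fun z hz => ?_) (h.map_boxMin_singleton hg hm hC t)
      exact hz.1.symm
    · rw [show Prod.mk y ⁻¹' S = ∅ from eq_empty_of_forall_notMem fun z hz => hy hz.2, measure_empty]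
  filter_upwards [measure_eq_zero_iff_ae_notMem.1 h0] with ω hω heq t ht
  exact hω ⟨heq, t, ht.symm⟩

end Boxes

/-! ### Lower bound for the probability of ordered box minima -/

theorem strictMono_snoc_iff {α : Type*} [Preorder α] {n : ℕ} (y : Fin (n + 1) → α) (a : α) :
    StrictMono (Fin.snoc y a : Fin (n + 2) → α) ↔ StrictMono y ∧ y (Fin.last n) < a := by
  rw [Fin.strictMono_iff_lt_succ, Fin.strictMono_iff_lt_succ]
  constructor
  · refine fun h => ⟨fun i => ?_, ?_⟩
    · have := h i.castSucc
      rwa [Fin.snoc_castSucc, Fin.succ_castSucc, Fin.snoc_castSucc] at this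
    · have := h (Fin.last n)
      rwa [Fin.snoc_castSucc, Fin.succ_last, Fin.snoc_last] at this
  · rintro ⟨h1, h2⟩ i
    induction i using Fin.lastCases with
    | last => rwa [Fin.snoc_castSucc, Fin.succ_last, Fin.snoc_last]
    | cast i =>
      rw [Fin.snoc_castSucc, Fin.succ_castSucc, Fin.snoc_castSucc]
      exact h1 i

theorem measurableSet_strictMono {n : ℕ} {α : Type*} [TopologicalSpace α] [MeasurableSpace α]
    [OpensMeasurableSpace α] [LinearOrder α] [OrderClosedTopology α] [SecondCountableTopology α] :
    MeasurableSet {y : Fin n → α | StrictMono y} := by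
  have : {y : Fin n → α | StrictMono y} = ⋂ i, ⋂ j, ⋂ (_ : i < j), {y | y i < y j} := by
    ext y
    simp only [mem_ofPred_eq, mem_iInter]
    exact ⟨fun h i j hij => h hij, fun h i j hij => h i j hij⟩
  rw [this]
  exact .iInter fun i => .iInter fun j => .iInter fun _ =>
    measurableSet_lt (measurable_pi_apply i) (measurable_pi_apply j)

section LowerBound

variable {X : Type*} [MeasurableSpace X] {Ω : Type*} [MeasurableSpace Ω] {P : Measure Ω}
  [IsProbabilityMeasure P] {μ : Measure X} [IsFiniteMeasure μ] {w : Ω → X → EReal} {g : X → EReal}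
  {m : ℝ}

theorem hazard_eq_sum_restrict {X : Type*} [MeasurableSpace X] {μ : Measure X} {g : X → EReal}
    {n : ℕ} {B : Fin n → Set X}
    (hB : ∀ i, MeasurableSet (B i)) (hd : Pairwise (Function.onFun Disjoint B)) (t : ℝ) :
    hazard μ g t = ∑ i, hazard (μ.restrict (B i)) g t + hazard (μ.restrict (⋃ i, B i)ᶜ) g t := by
  have h1 : ∑ i, hazard (μ.restrict (B i)) g t = hazard (μ.restrict (⋃ i, B i)) g t := by
    rw [hazard, lintegral_iUnion hB hd, tsum_fintype]
    rfl
  rw [h1]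
  exact (lintegral_add_compl _ (MeasurableSet.iUnion hB)).symm

/-- The boxes `B` followed by the rest of the space. -/
def boxesAndRest {n : ℕ} (B : Fin n → Set X) : Fin (n + 1) → Set X :=
  Fin.snoc B (⋃ i, B i)ᶜ

/-- By independence the density of the ordered minima, with the rest lying above `t_n`, is `∏
h_j(t_j) exp (-Λ_j(t_j))` times `exp (-Λ_rest(t_n))`. Replacing every `t_j` in the exponents by the
larger `t_n` decreases it and assembles `exp (-Λ(t_n))`. The loss accounts for boxes with a second
point below `t_n`. -/
theorem HasVoidProbabilities.le_measure_strictMono_boxMin (h : HasVoidProbabilities P μ w)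
    (hg : Measurable g) (hm : ∀ x, (m : EReal) ≤ g x) {n : ℕ} {B : Fin (n + 1) → Set X}
    (hB : ∀ i, MeasurableSet (B i)) (hd : Pairwise (Function.onFun Disjoint B)) :
    NullMeasurableSet {ω | StrictMono fun j => boxMin w g (boxesAndRest B j) ω} P ∧
    ∫⁻ t : Fin (n + 1) → ℝ in {t | StrictMono t},
        (∏ j, hazardRate (μ.restrict (B j)) g (t j)) * expNeg (hazard μ g (t (Fin.last n)))
      ≤ P {ω | StrictMono fun j => boxMin w g (boxesAndRest B j) ω} := by
  set D : Fin (n + 2) → Set X := boxesAndRest B with hDdef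
  have hDc : ∀ j : Fin (n + 1), D j.castSucc = B j := fun j => Fin.snoc_castSucc ..
  have hDl : D (Fin.last (n + 1)) = (⋃ i, B i)ᶜ := Fin.snoc_last ..
  have hD : ∀ i, MeasurableSet (D i) := fun i => by
    induction i using Fin.lastCases with
    | last => rw [hDl]; exact (MeasurableSet.iUnion hB).compl
    | cast i => rw [hDc]; exact hB i
  have hDd : Pairwise (Function.onFun Disjoint D) := by
    have hr : ∀ i, Disjoint (B i) (⋃ i, B i)ᶜ := fun i =>
      disjoint_compl_right_iff_subset.2 (subset_iUnion B i)
    intro i j hij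
    induction i using Fin.lastCases with
    | last =>
      induction j using Fin.lastCases with
      | last => exact absurd rfl hij
      | cast j => rw [Function.onFun, hDc, hDl]; exact (hr j).symm
    | cast i =>
      induction j using Fin.lastCases with
      | last => rw [Function.onFun, hDc, hDl]; exact hr i
      | cast j =>
        rw [Function.onFun, hDc, hDc]
        exact hd fun hij' => hij (by rw [hij'])
  have hY := fun i => h.aemeasurable_boxMin hg hm (hD i)
  have hL : ∀ i, IsProbabilityMeasure (P.map (boxMin w g (D i))) := fun i =>
    Measure.isProbabilityMeasure_map (hY i)
  have hYpi : AEMeasurable (fun ω i => boxMin w g (D i) ω) P := aemeasurable_pi_lambda _ hY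
  have hSM : MeasurableSet {y : Fin (n + 2) → EReal | StrictMono y} := measurableSet_strictMono
  have hSM' : MeasurableSet {y : Fin (n + 1) → EReal | StrictMono y} := measurableSet_strictMono
  have hSMR : MeasurableSet {y : Fin (n + 1) → ℝ | StrictMono y} := measurableSet_strictMono
  refine ⟨hYpi.nullMeasurable hSM, ?_⟩
  have hP : P {ω | StrictMono fun j => boxMin w g (D j) ω}
      = (Measure.pi fun i => P.map (boxMin w g (D i))) {y | StrictMono y} := by
    rw [← h.map_boxMin_eq_pi hg hm hD hDd, Measure.map_apply_of_aemeasurable hYpi hSM]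
    rfl
  have hfinL : ∀ j : Fin (n + 1), IsFiniteMeasure
      ((volume : Measure ℝ).withDensity (hazardDensity (μ.restrict (B j)) g)) := fun j => by
    rw [← h.comap_map_boxMin hg hm (hB j)]
    have : IsProbabilityMeasure (P.map (boxMin w g (B j))) := hDc j ▸ hL j.castSucc
    exact ⟨by rw [measurableEmbedding_coe_ereal.comap_apply]; exact measure_lt_top _ _⟩
  set c : (Fin (n + 1) → ℝ) → (Fin (n + 1) → EReal) := fun t j => (t j : EReal) with hc
  have hcm : Measurable c :=
    measurable_pi_lambda _ fun j => measurable_coe_real_ereal.comp (measurable_pi_apply j)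
  -- Pushed into `EReal`, the real densities give the laws of the minima restricted to the real
  -- values; what is lost at `⊤` makes this an inequality.
  have hmapc : (Measure.pi fun j => (volume : Measure ℝ).withDensity
        (hazardDensity (μ.restrict (B j)) g)).map c
      ≤ Measure.pi fun j : Fin (n + 1) => P.map (boxMin w g (D j.castSucc)) := by
    have h1 : ∀ j : Fin (n + 1), ((volume : Measure ℝ).withDensity
        (hazardDensity (μ.restrict (B j)) g)).map ((↑) : ℝ → EReal)
        = (P.map (boxMin w g (D j.castSucc))).restrict (range ((↑) : ℝ → EReal)) := fun j => by
      rw [hDc, ← h.comap_map_boxMin hg hm (hB j), measurableEmbedding_coe_ereal.map_comap]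
    rw [hc, Measure.pi_map_pi (f := fun _ => ((↑) : ℝ → EReal))
      (fun j => measurable_coe_real_ereal.aemeasurable)]
    simp only [h1]
    rw [← Measure.restrict_pi_pi]
    exact Measure.restrict_le_self
  set q : ℝ → ℝ≥0∞ := fun t => expNeg (hazard (μ.restrict (⋃ i, B i)ᶜ) g t) with hq
  have hqm : Measurable q := measurable_expNeg.comp (hazard_mono _ g).measurable
  calc ∫⁻ t : Fin (n + 1) → ℝ in {t | StrictMono t},
        (∏ j, hazardRate (μ.restrict (B j)) g (t j)) * expNeg (hazard μ g (t (Fin.last n)))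
      ≤ ∫⁻ t : Fin (n + 1) → ℝ in {t | StrictMono t},
        (∏ j, hazardDensity (μ.restrict (B j)) g (t j)) * q (t (Fin.last n)) := by
        refine setLIntegral_mono' hSMR fun t ht => ?_
        rw [hazard_eq_sum_restrict hB hd, expNeg_add
          (ENNReal.sum_ne_top.2 fun i _ => hazard_ne_top hm _) (hazard_ne_top hm _),
          expNeg_sum _ fun i _ => hazard_ne_top hm _, ← mul_assoc, ← Finset.prod_mul_distrib]
        gcongr with j
        refine mul_le_mul_right (expNeg_anti (hazard_mono _ _ ?_) (hazard_ne_top hm _)) _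
        exact ht.monotone (Fin.le_last j)
    _ = ∫⁻ t in {t | StrictMono t}, q (t (Fin.last n)) ∂(Measure.pi fun j =>
        (volume : Measure ℝ).withDensity (hazardDensity (μ.restrict (B j)) g)) := by
        have hdm : Measurable fun t : Fin (n + 1) → ℝ =>
            ∏ j, hazardDensity (μ.restrict (B j)) g (t j) :=
          Finset.measurable_fun_prod _ fun j _ =>
            (measurable_hazardDensity (μ.restrict (B j)) g).comp (measurable_pi_apply j)
        have hqm' : Measurable fun t : Fin (n + 1) → ℝ => q (t (Fin.last n)) :=
          hqm.comp (measurable_pi_apply _)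
        rw [pi_withDensity _ fun j => measurable_hazardDensity _ _,
          setLIntegral_withDensity_eq_setLIntegral_mul _ hdm hqm' hSMR]
        rfl
    _ = ∫⁻ t, {y : Fin (n + 1) → EReal | StrictMono y}.indicator (fun y =>
          P.map (boxMin w g (D (Fin.last (n + 1)))) (Ioi (y (Fin.last n)))) (c t)
          ∂(Measure.pi fun j => (volume : Measure ℝ).withDensity
            (hazardDensity (μ.restrict (B j)) g)) := by
        rw [← lintegral_indicator hSMR]
        refine lintegral_congr fun t => ?_
        have hiff : StrictMono t ↔ StrictMono (c t) :=
          ⟨fun ht => EReal.coe_strictMono.comp ht, fun ht i j hij => EReal.coe_lt_coe_iff.1 (ht hij)⟩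
        by_cases ht : StrictMono t
        · rw [indicator_of_mem (by exact ht), indicator_of_mem (by exact hiff.1 ht), hDl,
            h.map_boxMin_Ioi hg hm (MeasurableSet.iUnion hB).compl]
        · rw [indicator_of_notMem (by exact ht),
            indicator_of_notMem (by exact fun hn => ht (hiff.2 hn))]
    _ ≤ ∫⁻ y, {y : Fin (n + 1) → EReal | StrictMono y}.indicator (fun y =>
          P.map (boxMin w g (D (Fin.last (n + 1)))) (Ioi (y (Fin.last n)))) y
          ∂(Measure.pi fun j : Fin (n + 1) => P.map (boxMin w g (D j.castSucc))) := by
        rw [← lintegral_map (Measurable.indicator ?_ hSM') hcm]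
        · exact lintegral_mono' hmapc le_rfl
        · have hanti : Antitone fun y : EReal =>
              P.map (boxMin w g (D (Fin.last (n + 1)))) (Ioi y) := fun a b hab =>
            measure_mono (Ioi_subset_Ioi hab)
          exact hanti.measurable.comp (measurable_pi_apply _)
    _ = (Measure.pi fun i => P.map (boxMin w g (D i))) {y | StrictMono y} := by
        rw [← lintegral_indicator_one hSM, lintegral_pi_snoc _ (measurable_one.indicator hSM)]
        refine lintegral_congr fun y => ?_
        by_cases hy : StrictMono y
        · rw [indicator_of_mem (by exact hy), ← lintegral_indicator_one measurableSet_Ioi]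
          refine lintegral_congr fun a => ?_
          simp only [indicator, mem_ofPred_eq, strictMono_snoc_iff, hy, true_and, mem_Ioi,
            Pi.one_apply]
        · rw [indicator_of_notMem (by exact hy)]
          simp [indicator, strictMono_snoc_iff, hy]
    _ = P {ω | StrictMono fun j => boxMin w g (D j) ω} := hP.symm

end LowerBound

/-! ### Argmins of a fixed function with simple sublevels -/

section Deterministic

variable {X : Type*} {f : X → EReal}

/-- The finite values of `f` are pairwise distinct, infinite in number, and without accumulation
point. -/
structure HasSimpleSublevels (f : X → EReal) : Prop where
  ne_bot : ∀ x, f x ≠ ⊥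
  finite_le : ∀ t : ℝ, {x | f x ≤ (t : EReal)}.Finite
  injOn : ∀ x y, f x = f y → f x < ⊤ → x = y
  infinite : {x | f x < ⊤}.Infinite

theorem HasSimpleSublevels.exists_eq_infOn (hf : HasSimpleSublevels f) {A : Set X} {a : X}
    (ha : a ∈ A) (hat : f a < ⊤) : ∃ x ∈ A, f x = infOn f A ∧ f x < ⊤ := by
  obtain ⟨t, ht⟩ : ∃ t : ℝ, f a = t := ⟨(f a).toReal, (EReal.coe_toReal hat.ne (hf.ne_bot a)).symm⟩
  have hfin : (A ∩ {x | f x ≤ (t : EReal)}).Finite := (hf.finite_le t).inter_of_right A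
  obtain ⟨x, hx, hmin⟩ := exists_min_image _ f hfin ⟨a, ha, ht.le⟩
  have hxt : f x ≤ t := hx.2
  refine ⟨x, hx.1, le_antisymm (le_infOn_iff.2 fun y hy => ?_) (infOn_le hx.1),
    hxt.trans_lt (EReal.coe_lt_top t)⟩
  by_cases hyt : f y ≤ t
  · exact hmin y ⟨hy, hyt⟩
  · exact hxt.trans (not_le.1 hyt).le

/-- Only finitely many points are removed before each step, so a point with finite value remains.
Finite sublevel sets make the next infimum attained, and injectivity makes the minimizer unique. The
finiteness and the strict bound off the removed set are the invariants of the induction. -/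
theorem HasSimpleSublevels.kthMinAux_spec (hf : HasSimpleSublevels f) (k : ℕ) :
    (kthMinAux f k).2.Finite ∧ (∀ x ∉ (kthMinAux f k).2, (kthMinAux f k).1 < f x) ∧
      ∃ x, kthArgmins f (k + 1) = {x} ∧ kthMin f (k + 1) = f x ∧ f x < ⊤ ∧
        kthMin f k < f x := by
  have step : ∀ k, (kthMinAux f k).2.Finite → (∀ x ∉ (kthMinAux f k).2, (kthMinAux f k).1 < f x) →
      ∃ x, kthArgmins f (k + 1) = {x} ∧ kthMin f (k + 1) = f x ∧ f x < ⊤ ∧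
        kthMin f k < f x := by
    intro k h1 h2
    obtain ⟨a, hat, ha⟩ := (hf.infinite.sdiff h1).nonempty
    obtain ⟨x, hxA, hx, hxt⟩ := hf.exists_eq_infOn (A := (kthMinAux f k).2ᶜ) ha hat
    refine ⟨x, ?_, hx.symm, hxt, h2 x hxA⟩
    ext y
    refine ⟨fun hy => ?_, fun hy => ?_⟩
    · have hyx : f y = f x := hy.2.trans hx.symm
      exact hf.injOn y x hyx (hyx ▸ hxt)
    · rw [mem_singleton_iff.1 hy]
      exact ⟨h2 x hxA, hx⟩
  induction k with
  | zero =>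
    have h1 : (kthMinAux f 0).2.Finite := finite_empty
    have h2 : ∀ x ∉ (kthMinAux f 0).2, (kthMinAux f 0).1 < f x := fun x _ =>
      bot_lt_iff_ne_bot.2 (hf.ne_bot x)
    exact ⟨h1, h2, step 0 h1 h2⟩
  | succ k ih =>
    obtain ⟨h1, h2, x, hx, hmin, hxt, hlt⟩ := ih
    have hsnd : (kthMinAux f (k + 1)).2 = (kthMinAux f k).2 ∪ {x} := by
      rw [← hx]; rfl
    have h1' : (kthMinAux f (k + 1)).2.Finite := hsnd ▸ h1.union (finite_singleton x)
    have h2' : ∀ y ∉ (kthMinAux f (k + 1)).2, (kthMinAux f (k + 1)).1 < f y := by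
      intro y hy
      rw [hsnd, mem_union, not_or] at hy
      have hle : (kthMinAux f (k + 1)).1 ≤ f y := infOn_le (A := (kthMinAux f k).2ᶜ) hy.1
      have hfst : (kthMinAux f (k + 1)).1 = f x := hmin
      refine lt_of_le_of_ne hle fun heq => hy.2 ?_
      rw [hfst] at heq
      exact (hf.injOn x y heq hxt).symm
    exact ⟨h1', h2', step (k + 1) h1' h2'⟩

theorem HasSimpleSublevels.existsUnique_kthArgmins (hf : HasSimpleSublevels f) {k : ℕ}
    (hk : 1 ≤ k) : ∃! x, x ∈ kthArgmins f k := by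
  obtain ⟨k, rfl⟩ := Nat.exists_eq_add_of_le' hk
  obtain ⟨-, -, x, hx, -⟩ := hf.kthMinAux_spec k
  rw [hx]
  exact ⟨x, rfl, fun y hy => hy⟩

theorem HasSimpleSublevels.strictMono_argmins (hf : HasSimpleSublevels f) {n : ℕ}
    {x : Fin (n + 1) → X} (hx : ∀ j : Fin (n + 1), x j ∈ kthArgmins f ((j : ℕ) + 1)) :
    (StrictMono fun j => f (x j)) ∧ (∀ j, f (x j) < ⊤) ∧
      ∀ y, (∀ j, y ≠ x j) → f (x (Fin.last n)) < f y := by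
  have hxval : ∀ j : Fin (n + 1), f (x j) = kthMin f ((j : ℕ) + 1) ∧ f (x j) < ⊤ ∧
      kthMin f (j : ℕ) < f (x j) := fun j => by
    obtain ⟨-, -, y, hy, hmin, hyt, hlt⟩ := hf.kthMinAux_spec (j : ℕ)
    have hxy : x j = y := by
      have := hx j
      rwa [hy] at this
    exact hxy ▸ ⟨hmin.symm, hyt, hlt⟩
  refine ⟨Fin.strictMono_iff_lt_succ.2 fun j => ?_, fun j => (hxval j).2.1, fun y hy => ?_⟩
  · have h1 := (hxval j.castSucc).1
    have h2 := (hxval j.succ).2.2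
    rw [h1]
    exact h2
  · obtain ⟨-, h2, -⟩ := hf.kthMinAux_spec (n + 1)
    have hlast := (hxval (Fin.last n)).1
    rw [hlast]
    refine h2 y ?_
    rw [kthMinAux_snd]
    simp only [mem_iUnion, Finset.mem_Icc, not_exists]
    rintro i ⟨hi1, hi2⟩ hyi
    obtain ⟨i, rfl⟩ := Nat.exists_eq_add_of_le' hi1
    obtain ⟨-, -, z, hz, -⟩ := hf.kthMinAux_spec i
    have hxi : x ⟨i, by omega⟩ ∈ kthArgmins f (i + 1) := hx ⟨i, by omega⟩
    rw [hz] at hyi hxi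
    exact hy ⟨i, by omega⟩ (hyi.trans hxi.symm)

theorem strictMono_boxesAndRest_iff {n : ℕ} (B : Fin (n + 1) → Set X) :
    (StrictMono fun j => infOn f (boxesAndRest B j)) ↔
      (StrictMono fun j => infOn f (B j)) ∧
        infOn f (B (Fin.last n)) < infOn f (⋃ i, B i)ᶜ := by
  rw [← strictMono_snoc_iff (fun j => infOn f (B j)) (infOn f (⋃ i, B i)ᶜ)]
  have : (fun j => infOn f (boxesAndRest B j))
      = (Fin.snoc (fun j => infOn f (B j)) (infOn f (⋃ i, B i)ᶜ) : Fin (n + 2) → EReal) := by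
    funext j
    induction j using Fin.lastCases with
    | last => simp [boxesAndRest]
    | cast j => simp [boxesAndRest]
  rw [this]

/-- Every point other than the first `n + 1` argmins has a larger value, so when the argmins lie in
distinct boxes the infimum over each of these boxes is the value at its argmin. -/
theorem HasSimpleSublevels.strictMono_boxes (hf : HasSimpleSublevels f) {n : ℕ}
    {x : Fin (n + 1) → X} (hx : ∀ j : Fin (n + 1), x j ∈ kthArgmins f ((j : ℕ) + 1))
    {ι : Type*} (π : X → ι) (hπ : Function.Injective fun j => π (x j)) :
    StrictMono fun j => infOn f (boxesAndRest (fun j => π ⁻¹' {π (x j)}) j) := by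
  obtain ⟨hmono, htop, hrest⟩ := hf.strictMono_argmins hx
  have hB : ∀ j, infOn f (π ⁻¹' {π (x j)}) = f (x j) := fun j => by
    refine le_antisymm (infOn_le rfl) (le_infOn_iff.2 fun y hy => ?_)
    by_cases hyx : ∃ l, y = x l
    · obtain ⟨l, rfl⟩ := hyx
      rw [hπ (a₁ := l) (a₂ := j) hy]
    · push Not at hyx
      exact (hmono.monotone (Fin.le_last j)).trans (hrest y hyx).le
  rw [strictMono_boxesAndRest_iff]
  simp only [hB]
  refine ⟨hmono, ?_⟩
  have hlt : ∀ y ∈ (⋃ i, π ⁻¹' {π (x i)})ᶜ, f (x (Fin.last n)) < f y := fun y hy =>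
    hrest y fun j hj => hy (mem_iUnion.2 ⟨j, by rw [hj]; rfl⟩)
  -- Strictness could be lost when passing to the infimum; it survives because the infimum over the
  -- rest is either attained or equal to `⊤`.
  by_cases hex : ∃ a ∈ (⋃ i, π ⁻¹' {π (x i)})ᶜ, f a < ⊤
  · obtain ⟨a, ha, hat⟩ := hex
    obtain ⟨y, hy, hyi, -⟩ := hf.exists_eq_infOn ha hat
    rw [← hyi]
    exact hlt y hy
  · push Not at hex
    exact (htop _).trans_le (le_infOn_iff.2 hex)

/-- In such an ordering, box `i j` has a strictly smaller infimum than every box not among `i 0, …,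
i j`. At the first index where two orderings differ, each of the two boxes would lie strictly below
the other. -/
theorem eq_of_strictMono_boxes {n : ℕ} {ι : Type*} (π : X → ι) {i i' : Fin (n + 1) → ι}
    (h : StrictMono fun j => infOn f (boxesAndRest (fun j => π ⁻¹' {i j}) j))
    (h' : StrictMono fun j => infOn f (boxesAndRest (fun j => π ⁻¹' {i' j}) j)) : i = i' := by
  have key : ∀ i : Fin (n + 1) → ι,
      (StrictMono fun j => infOn f (boxesAndRest (fun j => π ⁻¹' {i j}) j)) →
      ∀ j b, (∀ l ≤ j, b ≠ i l) → infOn f (π ⁻¹' {i j}) < infOn f (π ⁻¹' {b}) := by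
    intro i hi j b hb
    rw [strictMono_boxesAndRest_iff] at hi
    by_cases hbi : ∃ l, b = i l
    · obtain ⟨l, rfl⟩ := hbi
      exact hi.1 (not_le.1 fun hl => hb l hl rfl)
    · push Not at hbi
      refine (hi.1.monotone (Fin.le_last j)).trans_lt (hi.2.trans_le ?_)
      refine le_infOn_iff.2 fun x hx => infOn_le ?_
      simp only [mem_compl_iff, mem_iUnion, not_exists]
      intro l hl
      exact hbi l (Eq.trans (Eq.symm hx) hl)
  have hinj : ∀ i : Fin (n + 1) → ι,
      (StrictMono fun j => infOn f (boxesAndRest (fun j => π ⁻¹' {i j}) j)) →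
      ∀ j l, i j = i l → j = l := fun i hi j l hjl => by
    rw [strictMono_boxesAndRest_iff] at hi
    refine hi.1.injective ?_
    rw [hjl]
  funext j
  induction j using WellFoundedLT.induction with
  | ind j ih =>
    by_contra hne
    have h1 := key i h j (i' j) fun l hl heq => by
      rcases hl.lt_or_eq with hl | rfl
      · rw [ih l hl] at heq
        exact hl.ne (hinj i' h' _ _ heq.symm)
      · exact hne heq.symm
    have h2 := key i' h' j (i j) fun l hl heq => by
      rcases hl.lt_or_eq with hl | rfl
      · rw [← ih l hl] at heq
        exact hl.ne (hinj i h _ _ heq.symm)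
      · exact hne heq
    exact lt_asymm h1 h2

end Deterministic

/-! ### Nested finite partitions from binary codes -/

/-- The first `n` entries of the binary sequence `b x`. -/
def code {X : Type*} (b : X → ℕ → Bool) (n : ℕ) (x : X) : Fin n → Bool := fun i => b x i

section Code

variable {X : Type*} {b : X → ℕ → Bool}

theorem measurable_code [MeasurableSpace X] (hb : Measurable b) (n : ℕ) : Measurable (code b n) :=
  measurable_pi_lambda _ fun _ => (measurable_pi_apply _).comp hb

theorem code_mono {m n : ℕ} (hmn : m ≤ n) {x y : X} (h : code b n x = code b n y) :
    code b m x = code b m y :=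
  funext fun i => congrFun h ⟨i, i.2.trans_le hmn⟩

theorem exists_code_ne (hb : Function.Injective b) {x y : X} (hxy : x ≠ y) :
    ∃ N, ∀ n ≥ N, code b n x ≠ code b n y := by
  obtain ⟨i, hi⟩ := Function.ne_iff.1 (hb.ne hxy)
  exact ⟨i + 1, fun n hn h => hi (congrFun h ⟨i, hn⟩)⟩

theorem exists_injOn_code (hb : Function.Injective b) {F : Set X} (hF : F.Finite) :
    ∃ N, ∀ n ≥ N, InjOn (code b n) F := by
  have h : ∀ p ∈ F ×ˢ F, ∃ N, ∀ n ≥ N, p.1 ≠ p.2 → code b n p.1 ≠ code b n p.2 := fun p _ => by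
    by_cases hp : p.1 = p.2
    · exact ⟨0, fun n _ hn => (hn hp).elim⟩
    · obtain ⟨N, hN⟩ := exists_code_ne hb hp
      exact ⟨N, fun n hn _ => hN n hn⟩
  have h' : ∀ p ∈ F ×ˢ F, ∀ᶠ n in atTop, p.1 ≠ p.2 → code b n p.1 ≠ code b n p.2 :=
    fun p hp => eventually_atTop.2 (h p hp)
  obtain ⟨N, hN⟩ := eventually_atTop.1 ((hF.prod hF).eventually_all.2 h')
  exact ⟨N, fun n hn x hx y hy hxy => by
    by_contra hne
    exact hN n hn (x, y) ⟨hx, hy⟩ hne hxy⟩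

theorem disjoint_code_preimage (b : X → ℕ → Bool) (n : ℕ) :
    Pairwise (Function.onFun Disjoint fun c : Fin n → Bool => code b n ⁻¹' {c}) := fun _ _ hcc' =>
  disjoint_left.2 fun _ hx hx' => hcc' ((Eq.symm hx).trans hx')

end Code

/-! ### Almost sure structure of `w + g` -/

section AlmostSure

variable {X : Type*} [MeasurableSpace X] {Ω : Type*} [MeasurableSpace Ω] {P : Measure Ω}
  [IsProbabilityMeasure P] {μ : Measure X} [IsFiniteMeasure μ] {w : Ω → X → EReal} {g : X → EReal}
  {m : ℝ} {b : X → ℕ → Bool}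

theorem sum_hazard_code {X : Type*} [MeasurableSpace X] {μ : Measure X} {g : X → EReal}
    {b : X → ℕ → Bool} (hb : Measurable b) (n : ℕ) (t : ℝ) :
    ∑ c : Fin n → Bool, hazard (μ.restrict (code b n ⁻¹' {c})) g t = hazard μ g t := by
  have hU : (⋃ c : Fin n → Bool, code b n ⁻¹' {c}) = univ := by
    ext x; simp
  rw [hazard, ← setLIntegral_univ, ← hU, lintegral_iUnion
    (fun c => measurable_code hb n (measurableSet_singleton c)) (disjoint_code_preimage b n),
    tsum_fintype]
  rfl

/-- The number `N n` of level-`n` boxes in which `w + g` drops below `s` has expectation at most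
`Λ(s)`, uniformly in `n`, so by Fatou its liminf is almost surely finite. Infinitely many points
below `s` would make it infinite, since any finitely many of them are eventually in different boxes.
-/
theorem HasVoidProbabilities.ae_finite_lt (h : HasVoidProbabilities P μ w) (hg : Measurable g)
    (hm : ∀ x, (m : EReal) ≤ g x) (hb : Measurable b) (hbi : Function.Injective b) (s : ℝ) :
    ∀ᵐ ω ∂P, {x | w ω x + g x < (s : EReal)}.Finite := by
  have hpre : ∀ n (c : Fin n → Bool), MeasurableSet (code b n ⁻¹' {c}) := fun n c =>
    measurable_code hb n (measurableSet_singleton c)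
  set A : (n : ℕ) → (Fin n → Bool) → Set Ω := fun n c =>
    {ω | (s : EReal) ≤ boxMin w g (code b n ⁻¹' {c}) ω}ᶜ with hA
  have hAm : ∀ n c, NullMeasurableSet (A n c) P := fun n c =>
    (h.boxMin_single hg hm (hpre n c) s).1.compl
  set N : ℕ → Ω → ℝ≥0∞ := fun n ω => ∑ c, (A n c).indicator 1 ω with hN
  have hNm : ∀ n, AEMeasurable (N n) P := fun n =>
    Finset.aemeasurable_fun_sum _ fun c _ => aemeasurable_one.indicator₀ (hAm n c)
  have hint : ∀ n, ∫⁻ ω, N n ω ∂P ≤ hazard μ g s := fun n => by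
    rw [hN, lintegral_finsetSum' _ (f := fun c ω => (A n c).indicator 1 ω)
      fun c _ => aemeasurable_one.indicator₀ (hAm n c), ← sum_hazard_code hb n s]
    refine Finset.sum_le_sum fun c _ => ?_
    rw [lintegral_indicator_one₀ (hAm n c),
      prob_compl_eq_one_sub₀ (h.boxMin_single hg hm (hpre n c) s).1,
      (h.boxMin_single hg hm (hpre n c) s).2]
    exact one_sub_expNeg_le (hazard_ne_top hm s)
  have hlim : ∫⁻ ω, liminf (fun n => N n ω) atTop ∂P ≠ ∞ := by
    refine ((lintegral_liminf_le' hNm).trans ?_).trans_lt (hazard_ne_top (μ := μ) hm s).lt_top |>.ne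
    exact liminf_le_of_frequently_le' (Frequently.of_forall hint)
  have hlimm : AEMeasurable (fun ω => liminf (fun n => N n ω) atTop) P := by
    refine ⟨fun ω => liminf (fun n => (hNm n).mk (N n) ω) atTop,
      Measurable.liminf fun n => (hNm n).measurable_mk, ?_⟩
    filter_upwards [ae_all_iff.2 fun n => (hNm n).ae_eq_mk] with ω hω
    simp only [hω]
  filter_upwards [ae_lt_top' hlimm hlim] with ω hω
  by_contra hinf
  refine hω.ne (ENNReal.eq_top_of_forall_nnreal_le fun r => ?_)
  obtain ⟨M, hM⟩ := exists_nat_ge r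
  obtain ⟨F, hFs, hFc⟩ := Set.Infinite.exists_subset_card_eq hinf M
  obtain ⟨N₀, hN₀⟩ := exists_injOn_code hbi F.finite_toSet
  refine le_liminf_of_le (by isBoundedDefault) (eventually_atTop.2 ⟨N₀, fun n hn => ?_⟩)
  classical
  calc (r : ℝ≥0∞) ≤ M := by exact_mod_cast hM
    _ = ∑ c ∈ F.image (code b n), 1 := by
        rw [Finset.sum_const, Finset.card_image_of_injOn (hN₀ n hn), hFc, nsmul_one]
    _ = ∑ c ∈ F.image (code b n), (A n c).indicator 1 ω := by
        refine Finset.sum_congr rfl fun c hc => ?_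
        obtain ⟨x, hx, rfl⟩ := Finset.mem_image.1 hc
        rw [indicator_of_mem]
        · rfl
        · refine fun hle => ?_
          have hx' : w ω x + g x < (s : EReal) := hFs hx
          exact absurd (le_infOn_iff.1 hle x rfl)
            (not_le.2 hx')
    _ ≤ N n ω := Finset.sum_le_sum_of_subset (Finset.subset_univ _)

/-- A tie between two points at a real value becomes, once boxes are fine enough, a tie between the
minima of two disjoint boxes. If only finitely many values were finite, the boxes missing those
points would cover the rest of `{g < ⊤}`; each would have minimum `⊤` and hence, almost surely,
carry no mass of `{g < ⊤}`. -/
theorem HasVoidProbabilities.ae_hasSimpleSublevels [NullSingletonClass μ]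
    [MeasurableSingletonClass X]
    (h : HasVoidProbabilities P μ w)
    (hg : Measurable g) (hm : ∀ x, (m : EReal) ≤ g x) (hfin : μ {x | g x < ⊤} ≠ 0)
    (hb : Measurable b) (hbi : Function.Injective b) :
    ∀ᵐ ω ∂P, HasSimpleSublevels fun x => w ω x + g x := by
  have hpre : ∀ n (c : Fin n → Bool), MeasurableSet (code b n ⁻¹' {c}) := fun n c =>
    measurable_code hb n (measurableSet_singleton c)
  have h1 : ∀ᵐ ω ∂P, ∀ s : ℕ, {x | w ω x + g x < ((s : ℝ) : EReal)}.Finite :=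
    ae_all_iff.2 fun s => h.ae_finite_lt hg hm hb hbi s
  have h2 : ∀ᵐ ω ∂P, ∀ n (c c' : Fin n → Bool), c ≠ c' →
      boxMin w g (code b n ⁻¹' {c}) ω = boxMin w g (code b n ⁻¹' {c'}) ω →
      ∀ t : ℝ, boxMin w g (code b n ⁻¹' {c}) ω ≠ t := by
    refine ae_all_iff.2 fun n => ae_all_iff.2 fun c => ae_all_iff.2 fun c' => ?_
    by_cases hcc' : c = c'
    · exact ae_of_all _ fun ω hne => (hne hcc').elim
    · filter_upwards [h.ae_boxMin_ne hg hm (hpre n c) (hpre n c') (disjoint_code_preimage b n hcc')]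
        with ω hω _ using hω
  have h3 : ∀ᵐ ω ∂P, ∀ n (c : Fin n → Bool),
      (μ.restrict (code b n ⁻¹' {c})) {x | g x < ⊤} ≠ 0 →
      boxMin w g (code b n ⁻¹' {c}) ω ≠ ⊤ := by
    refine ae_all_iff.2 fun n => ae_all_iff.2 fun c => ?_
    by_cases hc : (μ.restrict (code b n ⁻¹' {c})) {x | g x < ⊤} = 0
    · exact ae_of_all _ fun ω hne => (hne hc).elim
    · have h0 : P {ω | boxMin w g (code b n ⁻¹' {c}) ω = ⊤} = 0 := by
        refine le_antisymm (ge_of_tendsto (tendsto_expNeg_hazard_atTop hg hm hc)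
          (Eventually.of_forall fun t => ?_)) zero_le
        rw [← (h.boxMin_single hg hm (hpre n c) t).2]
        exact measure_mono fun ω (hω : _ = _) => by
          rw [mem_ofPred_eq, hω]; exact le_top
      filter_upwards [measure_eq_zero_iff_ae_notMem.1 h0] with ω hω _ using hω
  filter_upwards [h.ae_nonneg, h1, h2, h3] with ω hw hω1 hω2 hω3
  have hbot : ∀ x, w ω x + g x ≠ ⊥ := fun x hx => by
    rcases EReal.add_eq_bot_iff.1 hx with hx | hx
    · simpa [hx] using hw x
    · simpa [hx] using hm x
  have hfinite : ∀ t : ℝ, {x | w ω x + g x ≤ (t : EReal)}.Finite := fun t => by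
    obtain ⟨s, hs⟩ := exists_nat_gt t
    exact (hω1 s).subset fun x hx => lt_of_le_of_lt hx (EReal.coe_lt_coe_iff.2 hs)
  refine ⟨hbot, hfinite, fun x y hxy hxt => ?_, fun hF => ?_⟩
  · by_contra hne
    obtain ⟨t, ht⟩ : ∃ t : ℝ, w ω x + g x = t :=
      ⟨(w ω x + g x).toReal, (EReal.coe_toReal hxt.ne (hbot x)).symm⟩
    obtain ⟨n, hn⟩ := exists_injOn_code hbi (hfinite t)
    -- At level `n` the codes separate the finitely many points with value at most `t`, so a point
    -- with value `t` is alone among them in its box and gives the box minimum.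
    have hbox : ∀ z, w ω z + g z = t → boxMin w g (code b n ⁻¹' {code b n z}) ω = t := fun z hz => by
      refine le_antisymm ((infOn_le (f := fun x => w ω x + g x)
        (A := code b n ⁻¹' {code b n z}) (x := z) rfl).trans hz.le)
        (le_infOn_iff.2 fun v hv => ?_)
      by_contra hlt
      have hvz : v = z := hn n le_rfl (not_le.1 hlt).le hz.le hv
      rw [hvz, hz] at hlt
      exact hlt le_rfl
    have hcne : code b n x ≠ code b n y := fun hc =>
      hne (hn n le_rfl ht.le (hxy.symm.trans ht).le hc)
    exact hω2 n _ _ hcne ((hbox x ht).trans (hbox y (hxy.symm.trans ht)).symm) t (hbox x ht)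
  · set F := {x | w ω x + g x < ⊤} with hFdef
    refine hfin (le_antisymm ?_ zero_le)
    have hcover : ∀ x, g x < ⊤ → x ∈ F ∪ ⋃ n : ℕ,
        (⋃ c ∈ {c : Fin n → Bool | ∀ y ∈ F, code b n y ≠ c}, code b n ⁻¹' {c} ∩ {x | g x < ⊤}) := by
      intro x hx
      by_cases hxF : x ∈ F
      · exact Or.inl hxF
      · refine Or.inr ?_
        obtain ⟨n, hn⟩ := exists_injOn_code hbi (hF.insert x)
        refine mem_iUnion.2 ⟨n, mem_iUnion₂.2 ⟨code b n x, fun y hy heq => ?_, rfl, hx⟩⟩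
        have := hn n le_rfl (mem_insert_of_mem _ hy) (mem_insert _ _) heq
        exact hxF (this ▸ hy)
    refine (measure_mono hcover).trans ((measure_union_le _ _).trans ?_)
    -- The finite set `F` is null because `μ` has no atoms.
    rw [hF.countable.measure_zero μ, zero_add]
    refine (measure_iUnion_null fun n => (measure_biUnion_null_iff
      (Set.to_countable _)).2 fun c hc => ?_).le
    by_contra hpos
    have hmeas : MeasurableSet {x | g x < ⊤} := measurableSet_lt hg measurable_const
    have hne := hω3 n c (by rwa [Measure.restrict_apply hmeas, inter_comm])
    refine hne (top_le_iff.1 (le_infOn_iff.2 fun y hy => ?_))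
    by_contra hyt
    exact hc y (not_le.1 hyt) hy

end AlmostSure

/-! ### Telescoping of the kernels and mass of the claimed density -/

section Kernel

theorem shiftPos_lt_iff {X : Type*} {g : X → EReal} (hbot : ∀ x, g x ≠ ⊥) (r s : ℝ) (z : X) :
    shiftPos g r z < ((s - r : ℝ) : EReal) ↔ r < s ∧ g z < (s : EReal) := by
  rw [shiftPos]
  have hb := hbot z
  generalize g z = a at hb
  have h0 : (0 : EReal) = ((0 : ℝ) : EReal) := rfl
  induction a with
  | bot => exact absurd rfl hb
  | top => simp
  | coe a =>
    rw [max_lt_iff, ← EReal.coe_sub, h0, EReal.coe_lt_coe_iff, EReal.coe_lt_coe_iff,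
      EReal.coe_lt_coe_iff]
    constructor
    · rintro ⟨h1, h2⟩; constructor <;> linarith
    · rintro ⟨h1, h2⟩; constructor <;> linarith

/-- The increasing vectors of times that lie above `g` at the points `x j`. -/
def orderedAbove {X : Type*} (g : X → EReal) {n : ℕ} (x : Fin (n + 1) → X) :
    Set (Fin (n + 1) → ℝ) :=
  {t | StrictMono t ∧ ∀ j, g (x j) < (t j : EReal)}

theorem snoc_mem_orderedAbove {X : Type*} {g : X → EReal} {n : ℕ}
    {x : Fin (n + 2) → X} {r : Fin (n + 1) → ℝ} {s : ℝ} :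
    (Fin.snoc r s : Fin (n + 2) → ℝ) ∈ orderedAbove g x ↔
      r ∈ orderedAbove g (fun j => x j.castSucc) ∧
        r (Fin.last n) < s ∧ g (x (Fin.last (n + 1))) < (s : EReal) := by
  simp only [orderedAbove, mem_ofPred_eq, strictMono_snoc_iff, Fin.forall_fin_succ' (n := n + 1),
    Fin.snoc_castSucc, Fin.snoc_last]
  tauto

theorem mem_orderedAbove_zero {X : Type*} {g : X → EReal} {x : Fin 1 → X} {t : Fin 1 → ℝ} :
    t ∈ orderedAbove g x ↔ g (x 0) < (t 0 : EReal) := by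
  have h1 : StrictMono t := Subsingleton.strictMono t
  simp [orderedAbove, h1]

theorem measurableSet_orderedAbove {X : Type*} {g : X → EReal} {n : ℕ} (x : Fin (n + 1) → X) :
    MeasurableSet (orderedAbove g x) := by
  have : orderedAbove g x
      = {t | StrictMono t} ∩ ⋂ j, {t : Fin (n + 1) → ℝ | g (x j) < (t j : EReal)} := by
    ext; simp [orderedAbove]
  rw [this]
  exact measurableSet_strictMono.inter <| MeasurableSet.iInter fun j =>
    measurableSet_lt measurable_const (measurable_coe_real_ereal.comp (measurable_pi_apply j))

variable {X : Type*} [MeasureSpace X] {lam : X → ℝ} {g : X → EReal} {m : ℝ}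

/-- The measure with density `lam`. -/
noncomputable def intensity (lam : X → ℝ) : Measure X :=
  volume.withDensity fun x => ENNReal.ofReal (lam x)

theorem isFiniteMeasure_intensity (hlam : Integrable lam) (hpos : ∀ x, 0 < lam x) :
    IsFiniteMeasure (intensity lam) :=
  ⟨by rw [intensity, ← ofReal_setIntegral_eq_withDensity hlam hpos .univ]
      exact ENNReal.ofReal_lt_top⟩

open Classical in
theorem Psi_eq_ite (hlam : Integrable lam) (hpos : ∀ x, 0 < lam x) {h : X → EReal}
    (hh : Measurable h) (z : X) (t : ℝ) :
    Psi lam z t h = if h z < (t : EReal) then expNeg (hazard (intensity lam) h t) else 0 := by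
  rw [Psi, ofReal_survival hlam hpos hh, intensity]

theorem Phi_eq_lintegral_Psi (z : X) (h : X → EReal) :
    Phi lam z h = ∫⁻ t : ℝ, Psi lam z t h := by
  rw [Phi, ← lintegral_indicator (measurableSet_lt measurable_const measurable_coe_real_ereal)]
  refine lintegral_congr fun t => ?_
  simp only [Psi, indicator, mem_ofPred_eq]

open Classical in
-- One telescoping step: the accumulated factor `exp (-Λ(r))` times the restarted kernel is `exp
-- (-Λ(s))`, and the indicator in `Ψ` records both `r < s` and `g z < s`.
theorem Psi_shiftPos_mul (hlam : Integrable lam) (hpos : ∀ x, 0 < lam x) (hg : Measurable g)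
    (hm : ∀ x, (m : EReal) ≤ g x) (z : X) (r s : ℝ) :
    expNeg (hazard (intensity lam) g r) * Psi lam z (s - r) (shiftPos g r)
      = if r < s ∧ g z < (s : EReal) then expNeg (hazard (intensity lam) g s) else 0 := by
  have := isFiniteMeasure_intensity hlam hpos
  have hbot : ∀ x, g x ≠ ⊥ := fun x hx => by simpa [hx] using hm x
  rw [Psi_eq_ite hlam hpos (measurable_shiftPos hg r)]
  simp only [shiftPos_lt_iff hbot]
  by_cases h : r < s ∧ g z < (s : EReal)
  · rw [if_pos h, if_pos h, mul_comm, ← expNeg_add (hazard_ne_top (zero_le_shiftPos g r) _)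
      (hazard_ne_top hm _), hazard_shiftPos hg hbot _ _ (by linarith [h.1])]
    congr 2
    ring
  · rw [if_neg h, if_neg h, mul_zero]

open Classical in
theorem Phi_shiftPos_mul (hlam : Integrable lam) (hpos : ∀ x, 0 < lam x) (hg : Measurable g)
    (hm : ∀ x, (m : EReal) ≤ g x) (z : X) (r : ℝ) :
    expNeg (hazard (intensity lam) g r) * Phi lam z (shiftPos g r)
      = ∫⁻ s : ℝ, if r < s ∧ g z < (s : EReal) then expNeg (hazard (intensity lam) g s) else 0 := by
  -- Translation by `r` turns the waiting time after `r` into the absolute time `s`.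
  rw [Phi_eq_lintegral_Psi, ← lintegral_sub_right_eq_self _ r, ← lintegral_const_mul' _ _
    (expNeg_ne_top _)]
  exact lintegral_congr fun s => Psi_shiftPos_mul hlam hpos hg hm z r s

theorem prod_Psi_eq_indicator (hlam : Integrable lam) (hpos : ∀ x, 0 < lam x) (hg : Measurable g)
    (hm : ∀ x, (m : EReal) ≤ g x) : ∀ (n : ℕ) (x : Fin (n + 1) → X) (r : Fin (n + 1) → ℝ),
    Psi lam (x 0) (r 0) g * ∏ j : Fin n, Psi lam (x j.succ) (r j.succ - r j.castSucc)
        (shiftPos g (r j.castSucc))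
      = (orderedAbove g x).indicator
        (fun t => expNeg (hazard (intensity lam) g (t (Fin.last n)))) r
  | 0, x, r => by
    classical
    rw [Psi_eq_ite hlam hpos hg, Finset.univ_eq_empty, Finset.prod_empty, mul_one]
    by_cases h : g (x 0) < (r 0 : EReal)
    · rw [if_pos h, indicator_of_mem (mem_orderedAbove_zero.2 h)]
      rfl
    · rw [if_neg h, indicator_of_notMem (mt mem_orderedAbove_zero.1 h)]
  | n + 1, x, r => by
    classical
    have ih := prod_Psi_eq_indicator hlam hpos hg hm n (fun j => x j.castSucc)
      (fun j => r j.castSucc)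
    have hr : (Fin.snoc (fun j : Fin (n + 1) => r j.castSucc) (r (Fin.last (n + 1))) :
        Fin (n + 2) → ℝ) = r := Fin.snoc_init_self r
    have hmem := snoc_mem_orderedAbove (g := g) (x := x) (r := fun j => r j.castSucc)
      (s := r (Fin.last (n + 1)))
    rw [hr] at hmem
    rw [Fin.prod_univ_castSucc, ← mul_assoc]
    simp only [Fin.castSucc_zero, Fin.succ_castSucc] at ih ⊢
    rw [ih, Fin.succ_last]
    by_cases h1 : (fun j : Fin (n + 1) => r j.castSucc) ∈ orderedAbove g (fun j => x j.castSucc)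
    · rw [indicator_of_mem h1, Psi_shiftPos_mul hlam hpos hg hm, indicator]
      simp only [hmem, h1, true_and]
    · rw [indicator_of_notMem h1, zero_mul, indicator_of_notMem fun h => h1 (hmem.1 h).1]

/-- The `Ψ` factors telescope to `exp (-Λ(r_n))` on increasing vectors above `g`, and the final `Φ`
supplies the last time as one more integration variable. -/
theorem argminKernel_eq_lintegral (hlam : Integrable lam) (hpos : ∀ x, 0 < lam x)
    (hg : Measurable g) (hm : ∀ x, (m : EReal) ≤ g x) : ∀ (n : ℕ) (x : Fin (n + 1) → X),
    argminKernel lam g (n + 1) x = ∫⁻ t : Fin (n + 1) → ℝ, (orderedAbove g x).indicator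
      (fun t => expNeg (hazard (intensity lam) g (t (Fin.last n)))) t
  | 0, x => by
    classical
    rw [argminKernel, Phi_eq_lintegral_Psi,
      ← (volume_preserving_funUnique (Fin 1) ℝ).lintegral_comp_emb
        (MeasurableEquiv.measurableEmbedding _)]
    refine lintegral_congr fun t => ?_
    rw [Psi_eq_ite hlam hpos hg]
    by_cases h : g (x 0) < (t 0 : EReal)
    · rw [indicator_of_mem (mem_orderedAbove_zero.2 h)]
      exact if_pos h
    · rw [indicator_of_notMem (mt mem_orderedAbove_zero.1 h)]
      exact if_neg h
  | n + 1, x => by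
    classical
    have hmeas : Measurable fun t : Fin (n + 2) → ℝ =>
        expNeg (hazard (intensity lam) g (t (Fin.last (n + 1)))) :=
      (measurable_expNeg.comp (hazard_mono _ g).measurable).comp (measurable_pi_apply _)
    rw [argminKernel, volume_pi, volume_pi,
      lintegral_pi_snoc _ (hmeas.indicator (measurableSet_orderedAbove x))]
    refine lintegral_congr fun r => ?_
    have h := prod_Psi_eq_indicator hlam hpos hg hm n (fun j => x j.castSucc) r
    simp only [Fin.castSucc_zero] at h
    rw [mul_assoc, h, mul_comm]
    by_cases h1 : r ∈ orderedAbove g (fun j => x j.castSucc)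
    · rw [indicator_of_mem h1, Phi_shiftPos_mul hlam hpos hg hm]
      refine lintegral_congr fun s => ?_
      rw [indicator]
      simp only [snoc_mem_orderedAbove, h1, true_and, Fin.snoc_last]
    · rw [indicator_of_notMem h1, zero_mul]
      refine ((lintegral_congr fun s => ?_).trans lintegral_zero).symm
      exact indicator_of_notMem (fun hs => h1 (snoc_mem_orderedAbove.1 hs).1) _

/-- The joint density of the first `n + 1` values and argmins, without the factor `∏ lam (x j)`;
the values are in the second argument. -/
noncomputable def jointKernel (μ : Measure X) (g : X → EReal) {n : ℕ} (x : Fin (n + 1) → X)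
    (t : Fin (n + 1) → ℝ) : ℝ≥0∞ :=
  {t : Fin (n + 1) → ℝ | StrictMono t}.indicator
    (fun t => (∏ j, {p : X × ℝ | g p.1 ≤ (p.2 : EReal)}.indicator (1 : X × ℝ → ℝ≥0∞) (x j, t j)) *
      expNeg (hazard μ g (t (Fin.last n)))) t

/-- The kernels use `g (x j) < t j` while the hazard rate uses `≤`; the difference lies in finitely
many null hyperplanes of times. -/
theorem argminKernel_eq_lintegral_jointKernel (hlam : Integrable lam) (hpos : ∀ x, 0 < lam x)
    (hg : Measurable g) (hm : ∀ x, (m : EReal) ≤ g x) {n : ℕ} (x : Fin (n + 1) → X) :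
    argminKernel lam g (n + 1) x = ∫⁻ t, jointKernel (intensity lam) g x t := by
  classical
  rw [argminKernel_eq_lintegral hlam hpos hg hm]
  have hne : ∀ᵐ t : Fin (n + 1) → ℝ, ∀ j, g (x j) ≠ (t j : EReal) := ae_all_iff.2 fun j => by
    have h0 := Measure.pi_hyperplane (fun _ : Fin (n + 1) => (volume : Measure ℝ)) j (g (x j)).toReal
    filter_upwards [measure_eq_zero_iff_ae_notMem.1 h0] with t ht heq
    refine ht ?_
    rw [heq, EReal.toReal_coe]
  refine lintegral_congr_ae (hne.mono fun t ht => ?_)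
  rw [jointKernel]
  by_cases hmem : t ∈ orderedAbove g x
  · rw [indicator_of_mem hmem, indicator_of_mem (by exact hmem.1), Finset.prod_eq_one, one_mul]
    exact fun j _ => indicator_of_mem (by exact (hmem.2 j).le) _
  · rw [indicator_of_notMem hmem]
    by_cases hS : StrictMono t
    · obtain ⟨j, hj⟩ : ∃ j, ¬ g (x j) < (t j : EReal) := by
        by_contra! hall
        exact hmem ⟨hS, hall⟩
      rw [indicator_of_mem (by exact hS), Finset.prod_eq_zero (Finset.mem_univ j), zero_mul]
      exact indicator_of_notMem (s := {p : X × ℝ | g p.1 ≤ (p.2 : EReal)})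
        (fun hle => ht j (le_antisymm hle (not_lt.1 hj))) _
    · rw [indicator_of_notMem (by exact hS)]

theorem measurable_jointKernel (μ : Measure X) (hg : Measurable g) {n : ℕ} :
    Measurable fun p : (Fin (n + 1) → X) × (Fin (n + 1) → ℝ) => jointKernel μ g p.1 p.2 := by
  have hS : MeasurableSet {p : X × ℝ | g p.1 ≤ (p.2 : EReal)} :=
    measurableSet_le (hg.comp measurable_fst) (measurable_coe_real_ereal.comp measurable_snd)
  have h1 : Measurable fun p : (Fin (n + 1) → X) × (Fin (n + 1) → ℝ) =>
      (∏ j, {p : X × ℝ | g p.1 ≤ (p.2 : EReal)}.indicator (1 : X × ℝ → ℝ≥0∞) (p.1 j, p.2 j)) *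
      expNeg (hazard μ g (p.2 (Fin.last n))) := by
    refine Measurable.mul (Finset.measurable_fun_prod _ fun j _ => ?_) ?_
    · exact (measurable_one.indicator hS).comp
        (((measurable_pi_apply j).comp measurable_fst).prodMk
          ((measurable_pi_apply j).comp measurable_snd))
    · exact (measurable_expNeg.comp (hazard_mono μ g).measurable).comp
        ((measurable_pi_apply _).comp measurable_snd)
  have hS2 : MeasurableSet {p : (Fin (n + 1) → X) × (Fin (n + 1) → ℝ) | StrictMono p.2} :=
    measurable_snd measurableSet_strictMono
  exact h1.indicator hS2

/-- By Tonelli the times can be fixed first; the integral over the points then splits into one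
factor per coordinate, each a hazard rate restricted to `A j`. -/
theorem setLIntegral_argminDensity [SigmaFinite (volume : Measure X)] (hlam : Integrable lam)
    (hlamm : Measurable lam) (hpos : ∀ x, 0 < lam x)
    (hg : Measurable g) (hm : ∀ x, (m : EReal) ≤ g x) {n : ℕ} {A : Fin (n + 1) → Set X}
    (hA : ∀ j, MeasurableSet (A j)) :
    ∫⁻ x in univ.pi A, argminDensity lam g (n + 1) x
      = ∫⁻ t : Fin (n + 1) → ℝ in {t | StrictMono t},
        (∏ j, hazardRate ((intensity lam).restrict (A j)) g (t j)) *
          expNeg (hazard (intensity lam) g (t (Fin.last n))) := by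
  have hlm : Measurable fun x => ENNReal.ofReal (lam x) := hlamm.ennreal_ofReal
  have hprodm : Measurable fun x : Fin (n + 1) → X => ∏ j, ENNReal.ofReal (lam (x j)) :=
    Finset.measurable_fun_prod _ fun j _ => hlm.comp (measurable_pi_apply j)
  have hS : MeasurableSet {p : X × ℝ | g p.1 ≤ (p.2 : EReal)} :=
    measurableSet_le (hg.comp measurable_fst) (measurable_coe_real_ereal.comp measurable_snd)
  calc ∫⁻ x in univ.pi A, argminDensity lam g (n + 1) x
      = ∫⁻ x in univ.pi A, ∫⁻ t, (∏ j, ENNReal.ofReal (lam (x j))) *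
          jointKernel (intensity lam) g x t := by
        refine lintegral_congr fun x => ?_
        rw [argminDensity, argminKernel_eq_lintegral_jointKernel hlam hpos hg hm,
          lintegral_const_mul' _ _ (ENNReal.prod_ne_top fun j _ => ENNReal.ofReal_ne_top)]
    _ = ∫⁻ t, ∫⁻ x in univ.pi A, (∏ j, ENNReal.ofReal (lam (x j))) *
          jointKernel (intensity lam) g x t :=
        lintegral_lintegral_swap (f := fun x t => (∏ j, ENNReal.ofReal (lam (x j))) *
          jointKernel (intensity lam) g x t)
          ((hprodm.comp measurable_fst).mul (measurable_jointKernel _ hg)).aemeasurable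
    _ = ∫⁻ t : Fin (n + 1) → ℝ in {t | StrictMono t},
        (∏ j, hazardRate ((intensity lam).restrict (A j)) g (t j)) *
          expNeg (hazard (intensity lam) g (t (Fin.last n))) := by
        rw [← lintegral_indicator measurableSet_strictMono]
        refine lintegral_congr fun t => ?_
        by_cases ht : StrictMono t
        · rw [indicator_of_mem (by exact ht)]
          have h1 : ∀ x : Fin (n + 1) → X, (∏ j, ENNReal.ofReal (lam (x j))) *
              jointKernel (intensity lam) g x t
              = (∏ j, ENNReal.ofReal (lam (x j)) *
                {p : X × ℝ | g p.1 ≤ (p.2 : EReal)}.indicator (1 : X × ℝ → ℝ≥0∞) (x j, t j)) *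
                expNeg (hazard (intensity lam) g (t (Fin.last n))) := fun x => by
            rw [jointKernel, indicator_of_mem (by exact ht), Finset.prod_mul_distrib, mul_assoc]
          simp only [h1]
          rw [lintegral_mul_const' _ _ (expNeg_ne_top _), volume_pi, Measure.restrict_pi_pi,
            lintegral_pi_prod (f := fun j x => ENNReal.ofReal (lam x) *
                {p : X × ℝ | g p.1 ≤ (p.2 : EReal)}.indicator (1 : X × ℝ → ℝ≥0∞) (x, t j)) _ fun j => hlm.mul
              ((measurable_one.indicator hS).comp (measurable_id.prodMk measurable_const))]
          congr 1
          refine Finset.prod_congr rfl fun j _ => ?_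
          have hSj : MeasurableSet {x | g x ≤ (t j : EReal)} := measurableSet_le hg measurable_const
          rw [hazardRate, Measure.restrict_apply hSj, intensity,
            withDensity_apply _ (hSj.inter (hA j)), ← Measure.restrict_restrict hSj,
            ← lintegral_indicator hSj]
          refine lintegral_congr fun x => ?_
          simp only [indicator, mem_ofPred_eq, Pi.one_apply, mul_ite, mul_one, mul_zero]
        · rw [indicator_of_notMem (by exact ht)]
          refine (lintegral_congr fun x => ?_).trans lintegral_zero
          rw [jointKernel, indicator_of_notMem (by exact ht), mul_zero]

/-- Integrating out the last time over `(t_n, ∞)` turns `h exp (-Λ)` into `exp (-Λ(t_n))`, which is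
the same integral with one variable fewer. This gives total mass one for the claimed density. -/
theorem lintegral_strictMono_prod_hazardRate {μ : Measure X} [IsFiniteMeasure μ]
    (hg : Measurable g) (hm : ∀ x, (m : EReal) ≤ g x) (hfin : μ {x | g x < ⊤} ≠ 0) : ∀ n : ℕ,
    ∫⁻ t : Fin (n + 1) → ℝ in {t | StrictMono t},
      (∏ j, hazardRate μ g (t j)) * expNeg (hazard μ g (t (Fin.last n))) = 1
  | 0 => by
    have hU : {t : Fin 1 → ℝ | StrictMono t} = univ :=
      eq_univ_of_forall fun t => Subsingleton.strictMono t
    rw [hU, setLIntegral_univ, ← lintegral_hazardDensity hg hm hfin,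
      ← (volume_preserving_funUnique (Fin 1) ℝ).lintegral_comp_emb
        (MeasurableEquiv.measurableEmbedding _)]
    refine lintegral_congr fun t => ?_
    simp [hazardDensity]
  | n + 1 => by
    have hrm : ∀ k, Measurable fun t : Fin (k + 1) → ℝ =>
        (∏ j, hazardRate μ g (t j)) * expNeg (hazard μ g (t (Fin.last k))) := fun k =>
      (Finset.measurable_fun_prod _ fun j _ =>
        (hazardRate_mono μ g).measurable.comp (measurable_pi_apply j)).mul
        ((measurable_expNeg.comp (hazard_mono μ g).measurable).comp (measurable_pi_apply _))
    rw [← lintegral_strictMono_prod_hazardRate hg hm hfin n,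
      ← lintegral_indicator measurableSet_strictMono, ← lintegral_indicator measurableSet_strictMono,
      volume_pi, volume_pi, lintegral_pi_snoc _ ((hrm _).indicator measurableSet_strictMono)]
    refine lintegral_congr fun r => ?_
    by_cases hr : StrictMono r
    · rw [indicator_of_mem (by exact hr), ← setLIntegral_Ioi_hazardDensity hg hm hfin,
        ← lintegral_const_mul _ (measurable_hazardDensity μ g),
        ← lintegral_indicator measurableSet_Ioi]
      refine lintegral_congr fun a => ?_
      by_cases ha : r (Fin.last n) < a
      · rw [indicator_of_mem (by exact (strictMono_snoc_iff r a).2 ⟨hr, ha⟩),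
          indicator_of_mem (by exact ha)]
        simp only [Fin.prod_univ_castSucc (n := n + 1), Fin.snoc_castSucc, Fin.snoc_last]
        rw [hazardDensity, mul_assoc]
      · rw [indicator_of_notMem (by exact fun h => ha ((strictMono_snoc_iff r a).1 h).2),
          indicator_of_notMem (by exact ha)]
    · rw [indicator_of_notMem (by exact hr)]
      refine (lintegral_congr fun a => ?_).trans lintegral_zero
      exact indicator_of_notMem (by exact fun h => hr ((strictMono_snoc_iff r a).1 h).1) _

end Kernel

/-! ### Cylinder sets of tuples and collisions of codes -/

section TupleCode

variable {X : Type*} {b : X → ℕ → Bool} {k : ℕ}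

/-- The codes of length `N` of the entries of a tuple. -/
def tupleCode (b : X → ℕ → Bool) (k N : ℕ) (x : Fin k → X) : Fin k → Fin N → Bool :=
  fun j => code b N (x j)

theorem tupleCode_mono {M N : ℕ} (hMN : M ≤ N) {x y : Fin k → X}
    (h : tupleCode b k N x = tupleCode b k N y) : tupleCode b k M x = tupleCode b k M y :=
  funext fun j => code_mono hMN (congrFun h j)

theorem measurable_tupleCode [MeasurableSpace X] (hb : Measurable b) (N : ℕ) :
    Measurable (tupleCode b k N) :=
  measurable_pi_lambda _ fun j => (measurable_code hb N).comp (measurable_pi_apply j)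

/-- The tuples with two entries that have the same code of length `N`. -/
def codeCollision (b : X → ℕ → Bool) (k N : ℕ) : Set (Fin k → X) :=
  {x | ¬ Function.Injective (tupleCode b k N x)}

theorem antitone_codeCollision : Antitone (codeCollision b k) := fun _ _ hMN _ hx hinj =>
  hx fun _ _ hjl => hinj (code_mono hMN hjl)

theorem eventually_notMem_codeCollision (hb : Function.Injective b) {x : Fin k → X}
    (hx : Function.Injective x) : ∀ᶠ N in atTop, x ∉ codeCollision b k N := by
  obtain ⟨N, hN⟩ := exists_injOn_code hb (finite_range x)
  filter_upwards [eventually_ge_atTop N] with n hn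
  exact not_not.2 fun j l hjl => hx (hN n hn (mem_range_self j) (mem_range_self l) hjl)

theorem iInter_codeCollision (hb : Function.Injective b) :
    ⋂ N, codeCollision b k N = {x | ¬ Function.Injective x} := by
  ext x
  rw [mem_iInter]
  refine ⟨fun h hx => ?_, fun h N hinj => h fun j l hjl => hinj ?_⟩
  · obtain ⟨N, hN⟩ := (eventually_notMem_codeCollision hb hx).exists
    exact hN (h N)
  · simp only [tupleCode, hjl]

/-- A cylinder of level `M` is also one of any finer level `N`, which allows refinement while the
set stays fixed. -/
theorem preimage_image_tupleCode {M N : ℕ} (hMN : M ≤ N) (S : Set (Fin k → Fin M → Bool)) :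
    tupleCode b k N ⁻¹' (tupleCode b k N '' (tupleCode b k M ⁻¹' S)) = tupleCode b k M ⁻¹' S := by
  refine Subset.antisymm ?_ (subset_preimage_image _ _)
  rintro x ⟨y, hy, hyx⟩
  rw [mem_preimage, ← tupleCode_mono hMN hyx]
  exact hy

/-- The sets of tuples that are determined by finitely many entries of the codes. -/
def codeCylinders (b : X → ℕ → Bool) (k : ℕ) : Set (Set (Fin k → X)) :=
  {A | ∃ (N : ℕ) (S : Set (Fin k → Fin N → Bool)), A = tupleCode b k N ⁻¹' S}

theorem isPiSystem_codeCylinders : IsPiSystem (codeCylinders b k) := by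
  rintro _ ⟨M, S, rfl⟩ _ ⟨N, T, rfl⟩ -
  refine ⟨max M N, tupleCode b k (max M N) '' (tupleCode b k M ⁻¹' S) ∩
    tupleCode b k (max M N) '' (tupleCode b k N ⁻¹' T), ?_⟩
  rw [preimage_inter, preimage_image_tupleCode (le_max_left M N),
    preimage_image_tupleCode (le_max_right M N)]

theorem generateFrom_codeCylinders [MeasurableSpace X] (hb : MeasurableEmbedding b) :
    (inferInstance : MeasurableSpace (Fin k → X))
      = MeasurableSpace.generateFrom (codeCylinders b k) := by
  refine le_antisymm ?_ (MeasurableSpace.generateFrom_le ?_)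
  · refine iSup_le fun j => ?_
    rw [← hb.comap_eq, MeasurableSpace.comap_comp]
    refine measurable_iff_comap_le.1 ?_
    refine @measurable_pi_lambda _ _ _ (_) _ _ fun l => ?_
    refine fun T _ => MeasurableSpace.measurableSet_generateFrom
      ⟨l + 1, {i | i j (Fin.last l) ∈ T}, ?_⟩
    rfl
  · rintro _ ⟨N, S, rfl⟩
    exact measurable_tupleCode hb.measurable N S.toFinite.measurableSet

/-- Each diagonal `x j = x l` is null by Fubini, as its sections are points. -/
theorem measure_not_injective [MeasurableSpace X] [MeasurableEq X] (μ : Measure X)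
    [SigmaFinite μ] [NullSingletonClass μ] :
    (Measure.pi fun _ : Fin k => μ) {x | ¬ Function.Injective x} = 0 := by
  have hsub : {x : Fin k → X | ¬ Function.Injective x} ⊆
      ⋃ j, ⋃ l, ⋃ (_ : j ≠ l), {x | x j = x l} := by
    intro x hx
    have hx' : ¬ Function.Injective x := hx
    simp only [Function.Injective, not_forall] at hx'
    obtain ⟨j, l, hjl, hne⟩ := hx'
    exact mem_iUnion.2 ⟨j, mem_iUnion.2 ⟨l, mem_iUnion.2 ⟨hne, hjl⟩⟩⟩
  refine measure_mono_null hsub (measure_iUnion_null fun j => measure_iUnion_null fun l =>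
    measure_iUnion_null fun hne => ?_)
  cases k with
  | zero => exact j.elim0
  | succ k =>
    obtain ⟨i, rfl⟩ := Fin.exists_succAbove_eq hne.symm
    have hmp := measurePreserving_piFinSuccAbove (fun _ : Fin (k + 1) => μ) j
    have hS : MeasurableSet {p : X × (Fin k → X) | p.1 = p.2 i} :=
      measurableSet_eq_fun measurable_fst ((measurable_pi_apply i).comp measurable_snd)
    have hpre : {x : Fin (k + 1) → X | x j = x (j.succAbove i)}
        = MeasurableEquiv.piFinSuccAbove (fun _ => X) j ⁻¹' {p | p.1 = p.2 i} := rfl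
    rw [hpre, hmp.measure_preimage hS.nullMeasurableSet, Measure.prod_apply_symm hS]
    refine (lintegral_congr fun y => ?_).trans lintegral_zero
    exact measure_singleton (y i)

end TupleCode

/-! ### Measurability and joint law of the argmins -/

theorem measure_eq_of_le_of_compl_le {α : Type*} [MeasurableSpace α] {μ ν : Measure α}
    [IsProbabilityMeasure μ] [IsProbabilityMeasure ν] {A : Set α} (hA : MeasurableSet A)
    (h1 : ν A ≤ μ A) (h2 : ν Aᶜ ≤ μ Aᶜ) : μ A = ν A := by
  refine le_antisymm ?_ h1
  have := tsub_le_tsub_left h2 1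
  rwa [← prob_compl_eq_one_sub hA.compl, ← prob_compl_eq_one_sub hA.compl, compl_compl] at this

section Law

variable {X : Type*} [MeasureSpace X] {Ω : Type*} [MeasurableSpace Ω] {P : Measure Ω}
  [IsProbabilityMeasure P] {w : Ω → X → EReal} {g : X → EReal}
  {m : ℝ} {b : X → ℕ → Bool} {n : ℕ}

/-- The event that the `n + 1` smallest box minima occur, in this order, in the boxes with the codes
`i`. -/
def orderedBoxes (b : X → ℕ → Bool) (w : Ω → X → EReal) (g : X → EReal) (N : ℕ)
    (i : Fin (n + 1) → Fin N → Bool) : Set Ω :=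
  {ω | StrictMono fun j => boxMin w g (boxesAndRest (fun j => code b N ⁻¹' {i j}) j) ω}

theorem mem_orderedBoxes_iff {X Ω : Type*} {w : Ω → X → EReal} {g : X → EReal}
    {b : X → ℕ → Bool} {n : ℕ} {ω : Ω} (hf : HasSimpleSublevels fun x => w ω x + g x)
    {x : Fin (n + 1) → X}
    (hx : ∀ j : Fin (n + 1), x j ∈ kthArgmins (fun x => w ω x + g x) ((j : ℕ) + 1)) {N : ℕ}
    (hN : x ∉ codeCollision b (n + 1) N) {i : Fin (n + 1) → Fin N → Bool} :
    ω ∈ orderedBoxes b w g N i ↔ tupleCode b (n + 1) N x = i := by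
  have h1 : ω ∈ orderedBoxes b w g N (tupleCode b (n + 1) N x) :=
    hf.strictMono_boxes hx (code b N) (not_not.1 hN)
  exact ⟨fun hi => eq_of_strictMono_boxes (code b N) h1 hi, fun hi => hi ▸ h1⟩

theorem HasSimpleSublevels.injective_argmins {X : Type*} {n : ℕ} {f : X → EReal}
    (hf : HasSimpleSublevels f) {x : Fin (n + 1) → X}
    (hx : ∀ j : Fin (n + 1), x j ∈ kthArgmins f ((j : ℕ) + 1)) :
    Function.Injective x :=
  Function.Injective.of_comp (hf.strictMono_argmins hx).1.injective

theorem nullMeasurableSet_orderedBoxes {μ : Measure X} [IsFiniteMeasure μ]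
    (h : HasVoidProbabilities P μ w) (hg : Measurable g) (hm : ∀ x, (m : EReal) ≤ g x)
    (hb : Measurable b) {N : ℕ} {i : Fin (n + 1) → Fin N → Bool} (hi : Function.Injective i) :
    NullMeasurableSet (orderedBoxes b w g N i) P :=
  (h.le_measure_strictMono_boxMin hg hm
    (fun j => measurable_code hb N (measurableSet_singleton (i j)))
    (fun _ _ hjl => disjoint_code_preimage b N (hi.ne hjl))).1

/-- Once the boxes separate the argmins, their codes can be read off the events `orderedBoxes`. So
each event on the code of `V` is, up to a null set, an eventual value of null-measurable events. The
bits determine `V` because `b` is a measurable embedding. -/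
theorem aemeasurable_argmins {μ : Measure X} [IsFiniteMeasure μ]
    (h : HasVoidProbabilities P μ w) (hg : Measurable g) (hm : ∀ x, (m : EReal) ≤ g x)
    (hb : MeasurableEmbedding b) (hf : ∀ᵐ ω ∂P, HasSimpleSublevels fun x => w ω x + g x)
    {V : Ω → Fin (n + 1) → X}
    (hV : ∀ᵐ ω ∂P, ∀ j : Fin (n + 1), V ω j ∈ kthArgmins (fun x => w ω x + g x) ((j : ℕ) + 1)) :
    AEMeasurable V P := by
  have hcode : ∀ M, AEMeasurable (fun ω => tupleCode b (n + 1) M (V ω)) P := fun M => by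
    refine NullMeasurable.aemeasurable ?_
    have : @Measurable (NullMeasurableSpace Ω P) _ _ _ fun ω => tupleCode b (n + 1) M (V ω) := by
      refine measurable_to_countable' fun c => ?_
      change NullMeasurableSet ((fun ω => tupleCode b (n + 1) M (V ω)) ⁻¹' {c}) P
      set R : ℕ → Set Ω := fun N => ⋃ i ∈ {i : Fin (n + 1) → Fin N → Bool | Function.Injective i ∧
        ∃ x, tupleCode b (n + 1) N x = i ∧ tupleCode b (n + 1) M x = c}, orderedBoxes b w g N i
        with hR
      have hRm : ∀ N, NullMeasurableSet (R N) P := fun N =>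
        NullMeasurableSet.biUnion (to_countable _) fun i hi =>
          nullMeasurableSet_orderedBoxes h hg hm hb.measurable hi.1
      have hRl : NullMeasurableSet (⋃ N₀, ⋂ N ≥ N₀, R N) P :=
        NullMeasurableSet.iUnion fun N₀ => NullMeasurableSet.biInter (to_countable _)
          fun N _ => hRm N
      refine hRl.congr ?_
      filter_upwards [hf, hV] with ω hfω hVω
      have hev := eventually_notMem_codeCollision hb.injective (hfω.injective_argmins hVω)
      have hev' : ∀ᶠ N in atTop, (ω ∈ R N ↔ tupleCode b (n + 1) M (V ω) = c) := by
        filter_upwards [hev, eventually_ge_atTop M] with N hN hMN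
        simp only [hR, mem_iUnion, mem_orderedBoxes_iff hfω hVω hN]
        constructor
        · rintro ⟨i, ⟨-, x, hx, hxc⟩, hi⟩
          rw [← hxc]
          exact tupleCode_mono hMN (hi.trans hx.symm)
        · exact fun hc => ⟨_, ⟨not_not.1 hN, V ω, rfl, hc⟩, rfl⟩
      obtain ⟨N₁, hN₁⟩ := eventually_atTop.1 hev'
      refine propext ⟨fun hω => ?_, fun hω => ?_⟩
      · obtain ⟨N₀, hN₀⟩ := mem_iUnion.1 hω
        exact (hN₁ (max N₀ N₁) (le_max_right _ _)).1
          (mem_iInter₂.1 hN₀ (max N₀ N₁) (le_max_left _ _))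
      · exact mem_iUnion.2 ⟨N₁, mem_iInter₂.2 fun N hN => (hN₁ N hN).2 hω⟩
    exact this
  refine aemeasurable_pi_lambda _ fun j => hb.aemeasurable_comp_iff.1 ?_
  refine aemeasurable_pi_lambda _ fun l => ?_
  have hm' : Measurable fun i : Fin (n + 1) → Fin (l + 1) → Bool => i j (Fin.last l) :=
    (measurable_pi_apply _).comp (measurable_pi_apply j)
  exact hm'.comp_aemeasurable (hcode (l + 1))

/-- The claimed law `ν` is compared with the true law `ρ` on cylinders. The box estimate bounds `ν`
by `ρ` plus the collision masses; refining the boxes removes the error, and applying the result to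
complements gives equality. -/
theorem map_argmins_eq_withDensity [MeasurableEq X]
    [SigmaFinite (volume : Measure X)] [NullSingletonClass (volume : Measure X)]
    {lam : X → ℝ} (hlam : Integrable lam) (hlamm : Measurable lam) (hpos : ∀ x, 0 < lam x)
    (h : HasVoidProbabilities P (intensity lam) w) (hg : Measurable g)
    (hm : ∀ x, (m : EReal) ≤ g x) (hfin : intensity lam {x | g x < ⊤} ≠ 0)
    (hb : MeasurableEmbedding b) (hf : ∀ᵐ ω ∂P, HasSimpleSublevels fun x => w ω x + g x)
    {V : Ω → Fin (n + 1) → X}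
    (hV : ∀ᵐ ω ∂P, ∀ j : Fin (n + 1), V ω j ∈ kthArgmins (fun x => w ω x + g x) ((j : ℕ) + 1)) :
    P.map V = (volume : Measure (Fin (n + 1) → X)).withDensity
      (argminDensity lam g (n + 1)) := by
  have := isFiniteMeasure_intensity hlam hpos
  have hVm := aemeasurable_argmins h hg hm hb hf hV
  set ρ := P.map V with hρ
  have : IsProbabilityMeasure ρ := Measure.isProbabilityMeasure_map hVm
  set ν := (volume : Measure (Fin (n + 1) → X)).withDensity (argminDensity lam g (n + 1)) with hν
  have hνbox : ∀ {A : Fin (n + 1) → Set X}, (∀ j, MeasurableSet (A j)) →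
      ν (univ.pi A) = ∫⁻ t : Fin (n + 1) → ℝ in {t | StrictMono t},
        (∏ j, hazardRate ((intensity lam).restrict (A j)) g (t j)) *
          expNeg (hazard (intensity lam) g (t (Fin.last n))) := fun hA => by
    rw [hν, withDensity_apply _ (.univ_pi hA), setLIntegral_argminDensity hlam hlamm hpos hg hm hA]
  have : IsProbabilityMeasure ν := ⟨by
    rw [← pi_univ univ, hνbox fun _ => .univ]
    simp only [Measure.restrict_univ]
    exact lintegral_strictMono_prod_hazardRate hg hm hfin n⟩
  have hcm : ∀ N (S : Set (Fin (n + 1) → Fin N → Bool)),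
      MeasurableSet (tupleCode b (n + 1) N ⁻¹' S) := fun N S =>
    measurable_tupleCode hb.measurable N S.toFinite.measurableSet
  have hDm : ∀ N, MeasurableSet (codeCollision b (n + 1) N) := fun N =>
    hcm N {i | ¬ Function.Injective i}
  have hone : ∀ N (i : Fin (n + 1) → Fin N → Bool), Function.Injective i →
      ν (tupleCode b (n + 1) N ⁻¹' {i}) ≤ P (orderedBoxes b w g N i) := fun N i hi => by
    have hpi : tupleCode b (n + 1) N ⁻¹' {i} = univ.pi fun j => code b N ⁻¹' {i j} := by
      ext x
      simp only [mem_preimage, mem_singleton_iff, mem_univ_pi, funext_iff (f := tupleCode b _ N x)]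
      rfl
    rw [hpi, hνbox fun j => measurable_code hb.measurable N (measurableSet_singleton (i j))]
    exact (h.le_measure_strictMono_boxMin hg hm
      (fun j => measurable_code hb.measurable N (measurableSet_singleton (i j)))
      (fun _ _ hjl => disjoint_code_preimage b N (hi.ne hjl))).2
  -- The box estimate needs distinct boxes, and the ordered events reveal the codes of `V` only off
  -- collisions; these account for the two error terms.
  have hkey : ∀ N (S : Set (Fin (n + 1) → Fin N → Bool)),
      ν (tupleCode b (n + 1) N ⁻¹' S) ≤ ρ (tupleCode b (n + 1) N ⁻¹' S) +
        (ρ (codeCollision b (n + 1) N) + ν (codeCollision b (n + 1) N)) := fun N S => by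
    classical
    set I : Finset (Fin (n + 1) → Fin N → Bool) :=
      Finset.univ.filter fun i => i ∈ S ∧ Function.Injective i with hI
    have hmemI : ∀ {i}, i ∈ I ↔ i ∈ S ∧ Function.Injective i := by simp [hI]
    have hdisj : (I : Set (Fin (n + 1) → Fin N → Bool)).Pairwise
        (Function.onFun (AEDisjoint P) (orderedBoxes b w g N)) :=
      fun i _ i' _ hne => Disjoint.aedisjoint <| disjoint_left.2 fun ω hω hω' =>
        hne (eq_of_strictMono_boxes (code b N) hω hω')
    calc ν (tupleCode b (n + 1) N ⁻¹' S)
        ≤ ν ((⋃ i ∈ I, tupleCode b (n + 1) N ⁻¹' {i}) ∪ codeCollision b (n + 1) N) := by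
          refine measure_mono fun x hx => ?_
          by_cases hinj : Function.Injective (tupleCode b (n + 1) N x)
          · exact Or.inl (mem_iUnion₂.2 ⟨_, hmemI.2 ⟨hx, hinj⟩, rfl⟩)
          · exact Or.inr hinj
      _ ≤ (∑ i ∈ I, ν (tupleCode b (n + 1) N ⁻¹' {i})) + ν (codeCollision b (n + 1) N) :=
          (measure_union_le _ _).trans (by gcongr; exact measure_biUnion_finset_le _ _)
      _ ≤ (∑ i ∈ I, P (orderedBoxes b w g N i)) + ν (codeCollision b (n + 1) N) := by
          gcongr with i hi
          exact hone N i (hmemI.1 hi).2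
      _ = P (⋃ i ∈ I, orderedBoxes b w g N i) + ν (codeCollision b (n + 1) N) := by
          rw [measure_biUnion_finset₀ hdisj fun i hi =>
            nullMeasurableSet_orderedBoxes h hg hm hb.measurable (hmemI.1 hi).2]
      _ ≤ P (V ⁻¹' (tupleCode b (n + 1) N ⁻¹' S ∪ codeCollision b (n + 1) N)) +
            ν (codeCollision b (n + 1) N) := by
          gcongr ?_ + _
          refine measure_mono_ae ?_
          filter_upwards [hf, hV] with ω hfω hVω hω
          by_cases hc : V ω ∈ codeCollision b (n + 1) N
          · exact Or.inr hc
          · obtain ⟨i, hi, hωi⟩ := mem_iUnion₂.1 hω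
            rw [mem_orderedBoxes_iff hfω hVω hc] at hωi
            refine Or.inl ?_
            rw [mem_preimage, hωi]
            exact (hmemI.1 hi).1
      _ ≤ ρ (tupleCode b (n + 1) N ⁻¹' S) +
            (ρ (codeCollision b (n + 1) N) + ν (codeCollision b (n + 1) N)) := by
          rw [← Measure.map_apply_of_aemeasurable hVm ((hcm N S).union (hDm N)), ← add_assoc]
          gcongr
          exact measure_union_le _ _
  -- The collision sets decrease to the tuples with repeated entries, which are null for both laws.
  have hcoll : ∀ θ : Measure (Fin (n + 1) → X), IsFiniteMeasure θ →
      θ {x | ¬ Function.Injective x} = 0 →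
      Tendsto (fun N => θ (codeCollision b (n + 1) N)) atTop (𝓝 0) := fun θ _ h0 => by
    have := tendsto_measure_iInter_atTop (fun N => (hDm N).nullMeasurableSet (μ := θ))
      antitone_codeCollision ⟨0, measure_ne_top θ _⟩
    rwa [iInter_codeCollision hb.injective, h0] at this
  have hinjm : MeasurableSet {x : Fin (n + 1) → X | ¬ Function.Injective x} := by
    rw [← iInter_codeCollision hb.injective]
    exact MeasurableSet.iInter hDm
  have hρ0 : ρ {x | ¬ Function.Injective x} = 0 := by
    rw [hρ, Measure.map_apply_of_aemeasurable hVm hinjm]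
    refine measure_eq_zero_iff_ae_notMem.2 ?_
    filter_upwards [hf, hV] with ω hfω hVω
    exact not_not.2 (hfω.injective_argmins hVω)
  have hν0 : ν {x | ¬ Function.Injective x} = 0 :=
    withDensity_absolutelyContinuous _ _ (measure_not_injective volume)
  have hle : ∀ A ∈ codeCylinders b (n + 1), ν A ≤ ρ A := by
    rintro _ ⟨M, S, rfl⟩
    have hlim : Tendsto (fun N => ρ (tupleCode b (n + 1) M ⁻¹' S) +
        (ρ (codeCollision b (n + 1) N) + ν (codeCollision b (n + 1) N))) atTop
        (𝓝 (ρ (tupleCode b (n + 1) M ⁻¹' S) + (0 + 0))) :=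
      tendsto_const_nhds.add ((hcoll ρ inferInstance hρ0).add (hcoll ν inferInstance hν0))
    rw [add_zero, add_zero] at hlim
    refine ge_of_tendsto hlim ?_
    filter_upwards [eventually_ge_atTop M] with N hMN
    rw [← preimage_image_tupleCode hMN S]
    exact hkey N _
  refine ext_of_generate_finite _ (generateFrom_codeCylinders hb) isPiSystem_codeCylinders
    (fun A hA => ?_) (by rw [measure_univ, measure_univ])
  have hAc : Aᶜ ∈ codeCylinders b (n + 1) := by
    obtain ⟨N, S, rfl⟩ := hA
    exact ⟨N, Sᶜ, rfl⟩
  have hAm : MeasurableSet A := by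
    obtain ⟨N, S, rfl⟩ := hA
    exact hcm N S
  exact measure_eq_of_le_of_compl_le hAm (hle A hA) (hle _ hAc)

end Law

/-! ### The closure of the domain, and the theorem -/

theorem exists_real_le_lscFun {X : Type*} [TopologicalSpace X] [CompactSpace X] (g : LscFun X) :
    ∃ m : ℝ, ∀ x, (m : EReal) ≤ g x := by
  rcases isEmpty_or_nonempty X with hX | hX
  · exact ⟨0, fun x => hX.elim x⟩
  obtain ⟨a, -, ha⟩ := LowerSemicontinuousOn.exists_isMinOn (univ_nonempty (α := X)) isCompact_univ
    (g.lsc.lowerSemicontinuousOn univ)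
  obtain ⟨m, -, hm⟩ := EReal.lt_iff_exists_real_btwn.1 (bot_lt_iff_ne_bot.2 (g.ne_bot a))
  exact ⟨m, fun x => hm.le.trans (ha (mem_univ x))⟩

instance nullSingletonClass_intensity {X : Type*} [MeasureSpace X]
    [NullSingletonClass (volume : Measure X)] (lam : X → ℝ) : NullSingletonClass (intensity lam) :=
  ⟨fun x => withDensity_absolutelyContinuous _ _ (measure_singleton x)⟩

theorem nullSingletonClass_volume_subtype {α : Type*} [MeasureSpace α] [MeasurableSingletonClass α]
    [NullSingletonClass (volume : Measure α)] {s : Set α} (hs : MeasurableSet s) :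
    NullSingletonClass (volume : Measure s) :=
  ⟨fun x => by rw [← volume_image_subtype_coe hs, image_singleton, measure_singleton]⟩

theorem isFiniteMeasure_volume_subtype {α : Type*} [MeasureSpace α] {s : Set α}
    (hs : MeasurableSet s) (hfin : volume s ≠ ⊤) : IsFiniteMeasure (volume : Measure s) :=
  ⟨by rwa [Measure.Subtype.volume_univ hs.nullMeasurableSet, lt_top_iff_ne_top]⟩

end ExtremeValue


theorem theorem1 {d : ℕ} (hd : 1 ≤ d) (D : Set (EuclideanSpace ℝ (Fin d)))
    (hD_open : IsOpen D) (hD_conn : IsConnected D) (hD_bdd : Bornology.IsBounded D)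
    (lam : closure D → ℝ) (hlam_cont : Continuous lam) (hlam_pos : ∀ x, 0 < lam x)
    (g : LscFun (closure D)) (hg : volume {x : closure D | g x < ⊤} ≠ 0)
    {Ω : Type*} [MeasurableSpace Ω] (P : Measure Ω) [IsProbabilityMeasure P]
    (W : Ω → LscFun (closure D)) (hW : ExtremeValue.IsExtremeValueProcess P lam W) :
    (∀ᵐ ω ∂P, ∀ k : ℕ, 1 ≤ k →
      ∃! x, x ∈ ExtremeValue.kthArgmins (fun y => W ω y + g y) k) ∧
    (∀ k : ℕ, 1 ≤ k → ∀ X : Fin k → Ω → closure D,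
      (∀ᵐ ω ∂P, ∀ j : Fin k,
        X j ω ∈ ExtremeValue.kthArgmins (fun y => W ω y + g y) ((j : ℕ) + 1)) →
      HasLaw (fun ω j => X j ω)
        ((volume : Measure (Fin k → closure D)).withDensity
          (ExtremeValue.argminDensity lam g k)) P) := by
  have : Nonempty (Fin d) := Fin.pos_iff_nonempty.1 hd
  have hcpt : IsCompact (closure D) := hD_bdd.isCompact_closure
  have : CompactSpace (closure D) := isCompact_iff_compactSpace.1 hcpt
  have hmeas : MeasurableSet (closure D) := isClosed_closure.measurableSet
  have : PolishSpace (closure D) := isClosed_closure.polishSpace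
  have : IsFiniteMeasure (volume : Measure (closure D)) :=
    ExtremeValue.isFiniteMeasure_volume_subtype hmeas hcpt.measure_lt_top.ne
  have : NullSingletonClass (volume : Measure (closure D)) :=
    ExtremeValue.nullSingletonClass_volume_subtype hmeas
  have hint : Integrable lam :=
    hlam_cont.integrable_of_hasCompactSupport (HasCompactSupport.of_compactSpace lam)
  have := ExtremeValue.isFiniteMeasure_intensity hint hlam_pos
  have hgm : Measurable g := g.lsc.measurable
  obtain ⟨m, hm⟩ := ExtremeValue.exists_real_le_lscFun g
  -- As `λ` is positive, the intensity has the same null sets as Lebesgue measure.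
  have hfin : ExtremeValue.intensity lam {x | g x < ⊤} ≠ 0 := by
    rw [ExtremeValue.intensity, Ne, withDensity_apply_eq_zero hlam_cont.measurable.ennreal_ofReal]
    simpa [hlam_pos] using hg
  obtain ⟨b, hb, hbi⟩ :=
    MeasurableSpace.measurable_injection_nat_bool_of_countablySeparated (closure D)
  have hclosed : ExtremeValue.HasClosedVoidProbabilities P (ExtremeValue.intensity lam)
      fun ω => (W ω : closure D → EReal) := hW.hasClosedVoidProbabilities hint hlam_pos
  have hvoid := hclosed.hasVoidProbabilities
  have hsimple := hvoid.ae_hasSimpleSublevels hgm hm hfin hb hbi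
  refine ⟨?_, fun k hk X hX => ?_⟩
  · filter_upwards [hsimple] with ω hω k hk
    exact hω.existsUnique_kthArgmins hk
  · obtain ⟨n, rfl⟩ := Nat.exists_eq_add_of_le' hk
    -- An injective Borel map between Polish spaces is a measurable embedding (Lusin–Souslin).
    have hbe : MeasurableEmbedding b := hb.measurableEmbedding hbi
    exact ⟨ExtremeValue.aemeasurable_argmins hvoid hgm hm hbe hsimple hX,
      ExtremeValue.map_argmins_eq_withDensity hint hlam_cont.measurable hlam_pos hvoid hgm hm hfin
        hbe hsimple hX⟩
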